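/- Let $\mathbb F$ be an algebraically closed field and let $q\in\mathbb F$ be nonzero and not a root of unity. **The algebras.** The universal Askey--Wilson algebra $\triangle_q$ is the unital associative $\mathbb F$-algebra with generators $A,B,C$ and the relations that each of $$A+\frac{qBC-q^{-1}CB}{q^2-q^{-2}},\qquad B+\frac{qCA-q^{-1}AC}{q^2-q^{-2}},\qquad C+\frac{qAB-q^{-1}BA}{q^2-q^{-2}}$$ commutes with $A,B,C$. The universal DAHA $\mathfrak H_q$ of type $(C_1^\vee,C_1)$ is the unital associative $\mathbb F$-algebra with generators $t_i^{\pm1}$ ($i=0,1,2,3$) and the relations $t_it_i^{-1}=t_i^{-1}t_i=1$, $t_i+t_i^{-1}$ is central ($i=0,1,2,3$), and $t_0t_1t_2t_3=q^{-1}$. There is a homomorphism $\zeta:\triangle_q\to\mathfrak H_q$ with $$A\mapsto t_1t_0+(t_1t_0)^{-1},\qquad B\mapsto t_3t_0+(t_3t_0)^{-1},\qquad C\mapsto t_2t_0+(t_2t_0)^{-1},$$ and every $\mathfrak H_q$-module is regarded as a $\triangle_q$-module by pulling back along $\zeta$. For an $\mathfrak H_q$-module $V$ and $\theta\in\mathbb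 F$ put $V(\theta)=\{v\in V\mid t_0v=\theta v\}$; this is a $\triangle_q$-submodule of $V$. For an $\mathfrak H_q$-module $V$ let $V^{3\bmod 4}$ be the $\mathfrak H_q$-module with the same underlying vector space on which $t_0,t_1,t_2,t_3$ act as $t_3,t_0,t_1,t_2$, respectively, act on $V$. **The module.** Let $d\ge 1$ be an odd integer and let $k_0,k_1,k_2,k_3\in\mathbb F$ be nonzero with $k_0^2=q^{-d-1}$. Put $\varrho_i=(k_0k_1k_3q^i-k_2)(k_0k_1k_3q^i-k_2^{-1})$ for $i=1,3,\dots,d$ and $\varrho_i=(1-q^i)(1-k_0^2q^i)$ for $i=2,4,\dots,d-1$. Let $E=E(k_0,k_1,k_2,k_3)$ be the $(d+1)$-dimensional $\mathfrak H_q$-module with basis $v_0,\dots,v_d$ and the following action. * $t_0v_0=k_0v_0$ and $t_0v_d=k_0v_d$. For $i=2,4,\dots,d-1$, $t_0v_i=k_0^{-1}q^{-i}\varrho_iv_{i-1}+(k_0+k_0^{-1}-k_0^{-1}q^{-i})v_i$. For $i=1,3,\dots,d-2$, $t_0v_i=k_0^{-1}q^{-i-1}(v_i-v_{i+1})$. *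 $t_1v_0=k_1v_0+k_1^{-1}v_1$. For $i=2,4,\dots,d-1$, $t_1v_i=-k_1\varrho_iv_{i-1}+k_1v_i+k_1^{-1}v_{i+1}$. For $i=1,3,\dots,d$, $t_1v_i=k_1^{-1}v_i$. * For $i=0,2,\dots,d-1$, $t_2v_i=k_0^{-1}k_1^{-1}k_3^{-1}q^{-i-1}(v_i-v_{i+1})$. For $i=1,3,\dots,d$, $t_2v_i=\frac{\varrho_i}{k_0k_1k_3q^i}v_{i-1}+(k_2+k_2^{-1}-k_0^{-1}k_1^{-1}k_3^{-1}q^{-i})v_i$. * For $i=0,2,\dots,d-1$, $t_3v_i=k_3v_i$. For $i=1,3,\dots,d-2$, $t_3v_i=-k_3^{-1}\varrho_iv_{i-1}+k_3^{-1}v_i+k_3v_{i+1}$. Finally $t_3v_d=-k_3^{-1}\varrho_dv_{d-1}+k_3^{-1}v_d$. **Theorem.** Assume that the $\mathfrak H_q$-module $E$ is irreducible, and write $E^{3}=E^{3\bmod 4}$. 1. If $k_3^2=1$, then the lattice of $\triangle_q$-submodules of $E^{3}$ is the chain $\{0\}\subset E^{3}(k_3)\subset E^{3}$: these are all the $\triangle_q$-submodules,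 and both inclusions are strict. 2. If $k_3^2\neq1$, then the lattice of $\triangle_q$-submodules of $E^{3}$ is the diamond consisting of $\{0\}$, $E^{3}(k_3)$, $E^{3}(k_3^{-1})$ and $E^{3}$: these four are pairwise distinct, they are all the $\triangle_q$-submodules, and neither of $E^{3}(k_3)$ and $E^{3}(k_3^{-1})$ contains the other. -/

import Mathlib

namespace DAHAAux

variable {R : Type*} [Ring R]

theorem commute_of_central {x x' y y' : R} (hy : y * y' = 1) (hy' : y' * y = 1)
    (cx : ∀ z, Commute (x + x') z) (cy : ∀ z, Commute (y + y') z) :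
    Commute (x * y + y' * x') y := by
  have e1 : (y + y') * x = x * (y + y') := cy x
  have e2 : (x + x') * y = y * (x + x') := cx y
  have e3 : y' * x' * y = y' * (y * (x + x')) - y' * x * y := by
    rw [← e2]; noncomm_ring
  have e4 : y' * (y * (x + x')) = x + x' := by rw [← mul_assoc, hy', one_mul]
  have e5 : y' * x * y = x * y * y + x * (y' * y) - y * x * y := by
    have : y' * x = x * (y + y') - y * x := by rw [← e1]; noncomm_ring
    rw [this]; noncomm_ring
  show (x * y + y' * x') * y = y * (x * y + y' * x')
  rw [add_mul, e3, e4, e5, hy', mul_add, ← mul_assoc y y', hy]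
  noncomm_ring

variable {F : Type*} [Field F] [Algebra F R]

theorem conj_eq {x x' K L : R} (h1 : x * x' = 1) (h : Commute K x) (hL : x * K * x' = L) : K = L := by
  rw [← hL, ← h.eq, mul_assoc, h1, mul_one]

theorem aw_identity (q : F) (hq : q ≠ 0)
    {a a' b b' c c' : R} (ha : a * a' = 1) (ha' : a' * a = 1)
    (hb : b * b' = 1) (hb' : b' * b = 1) (hc : c * c' = 1) (hc' : c' * c = 1)
    (ca : ∀ z, Commute (a + a') z) (cb : ∀ z, Commute (b + b') z) (cc : ∀ z, Commute (c + c') z)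
    (cK : ∀ z, Commute (q • (b * c * a) + q⁻¹ • (a' * c' * b')) z) :
    (q ^ 2 - (q ^ 2)⁻¹) • (q⁻¹ • (c' * b') + q • (b * c))
      + q • ((c * a + a' * c') * (b * a + a' * b'))
      - q⁻¹ • ((b * a + a' * b') * (c * a + a' * c'))
    = (q - q⁻¹) • ((c + c') * (b + b') +
      (q • (b * c * a) + q⁻¹ • (a' * c' * b')) * (q • a' + q⁻¹ • a)) := by
  have ra : ∀ z, z * a * a' = z := fun z => by rw [mul_assoc, ha, mul_one]
  have ra' : ∀ z, z * a' * a = z := fun z => by rw [mul_assoc, ha', mul_one]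
  have rb : ∀ z, z * b * b' = z := fun z => by rw [mul_assoc, hb, mul_one]
  have rb' : ∀ z, z * b' * b = z := fun z => by rw [mul_assoc, hb', mul_one]
  have rc : ∀ z, z * c * c' = z := fun z => by rw [mul_assoc, hc, mul_one]
  have rc' : ∀ z, z * c' * c = z := fun z => by rw [mul_assoc, hc', mul_one]
  have hB : Commute (c * a + a' * c') a := commute_of_central ha ha' cc ca
  have hC : Commute (b * a + a' * b') a := commute_of_central ha ha' cb ca
  have hBa : (c * a + a' * c') * a' = a' * (c * a + a' * c') := by
    calc _ = a' * (a * (c * a + a' * c')) * a' := by rw [← mul_assoc a', ha', one_mul]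
      _ = _ := by rw [← hB.eq, ← mul_assoc a', ra]
  have hCa : b * a + a' * b' = a * b + b' * a' := by
    refine conj_eq ha hC ?_
    simp only [mul_add, add_mul, ← mul_assoc, ra, ha, one_mul]
  have hBC : (c * a + a' * c') * (b * a + a' * b')
      = c * a * b * a + a' * c' * b * a + a' * c * a * b' + a' * a' * c' * b' := by
    rw [mul_add, ← mul_assoc _ a', hBa]
    simp only [mul_add, add_mul, ← mul_assoc]
    abel
  have hCB : (b * a + a' * b') * (c * a + a' * c')
      = a * b * c * a + b' * a' * c * a + b * c' + a' * b' * a' * c' := by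
    have h1 : (b * a + a' * b') * (c * a) = a * b * c * a + b' * a' * c * a := by
      rw [hCa]; simp only [add_mul, ← mul_assoc]
    rw [mul_add, h1]
    simp only [add_mul, ← mul_assoc, ra]
    abel
  have K1 : q • (b * c * a) + q⁻¹ • (a' * c' * b') = q • (a * b * c) + q⁻¹ • (c' * b' * a') := by
    refine conj_eq ha (cK a) ?_
    simp only [mul_add, add_mul, mul_smul_comm, smul_mul_assoc, ← mul_assoc, ra, ha, one_mul]
  have K2 : q • (b * c * a) + q⁻¹ • (a' * c' * b') = q • (c * a * b) + q⁻¹ • (b' * a' * c') := by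
    refine conj_eq hb' (cK b') ?_
    simp only [mul_add, add_mul, mul_smul_comm, smul_mul_assoc, ← mul_assoc, rb', hb', one_mul]
  have K3 : q • (c * a * b) + q⁻¹ • (b' * a' * c') = q • (a * b * c) + q⁻¹ • (c' * b' * a') :=
    K2.symm.trans K1
  have G3 : q • (c * a * b * a) + q⁻¹ • (b' * a' * c' * a)
      = q • (a * b * c * a) + q⁻¹ • (c' * b') := by
    have := congrArg (· * a) K3
    simpa only [add_mul, smul_mul_assoc, ra'] using this
  have G5 : q • (a' * c * a * b) + q⁻¹ • (a' * b' * a' * c')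
      = q • (b * c) + q⁻¹ • (a' * c' * b' * a') := by
    have := congrArg (a' * ·) K3
    simpa only [mul_add, mul_smul_comm, ← mul_assoc, ha', one_mul] using this
  have G1 : c' * b' + c * b' = b' * a' * c * a + b' * a' * c' * a := by
    have h := (cc (b' * a')).eq
    have := congrArg (· * a) h
    simp only [mul_add, add_mul, ← mul_assoc, ra'] at this
    rw [add_comm, this]
  have S0 : c * a * b + c' * b * a + c * a * b' + a' * c' * b'
      - a * b * c' - a * c * b' - a * b * c - c' * b' * a' = 0 := by
    have e1 : c * a * b + c * a * b' = b * c * a + b' * c * a := by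
      have := (cb (c * a)).eq
      simp only [mul_add, add_mul, ← mul_assoc] at this
      exact this.symm
    have e2 : a * b * c + a * b * c' = a * c * b + a * c' * b := by
      have := congrArg (a * ·) (cc b).eq
      simp only [mul_add, add_mul, ← mul_assoc] at this
      exact this.symm
    have e3 : a * c' * b' + a' * c' * b' = c' * b' * a + c' * b' * a' := by
      have := (ca (c' * b')).eq
      simpa only [mul_add, add_mul, ← mul_assoc] using this
    have e4 : b * c' * a + b' * c' * a = c' * b * a + c' * b' * a := by
      have := congrArg (· * a) (cb c').eq
      simpa only [mul_add, add_mul, ← mul_assoc] using this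
    have e5 : b * c * a + b' * c * a + (b * c' * a + b' * c' * a)
        = a * c * b + a * c' * b + (a * c * b' + a * c' * b') := by
      have : (b + b') * (c + c') * a = a * ((c + c') * (b + b')) := by
        rw [(cb (c + c')).eq, ((cc a).mul_left (cb a)).eq]
      simpa only [mul_add, add_mul, ← mul_assoc] using this
    linear_combination (norm := abel) e1 - e2 + e3 - e4 + e5
  have S1 : a' * c * a * b + a' * c' * b * a + a' * c * a * b' + a' * a' * c' * b'
      - b * c' - a' * a * c * b' - b * c - a' * c' * b' * a' = 0 := by
    have := congrArg (a' * ·) S0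
    simpa only [mul_add, mul_sub, mul_zero, ← mul_assoc, ha', one_mul] using this
  have RK : (q • (b * c * a) + q⁻¹ • (a' * c' * b')) * (q • a' + q⁻¹ • a)
      = q • (q • (b * c) + q⁻¹ • (a' * c' * b' * a'))
        + q⁻¹ • (q • (a * b * c * a) + q⁻¹ • (c' * b')) := by
    have h1 : (q • (b * c * a) + q⁻¹ • (a' * c' * b')) * a'
      = q • (b * c) + q⁻¹ • (a' * c' * b' * a') := by
      simp only [add_mul, smul_mul_assoc, ra]
    have h2 : (q • (b * c * a) + q⁻¹ • (a' * c' * b')) * a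
      = q • (a * b * c * a) + q⁻¹ • (c' * b') := by
      rw [(cK a).eq]
      simp only [mul_add, mul_smul_comm, ← mul_assoc, ha, one_mul]
    rw [mul_add, mul_smul_comm, mul_smul_comm, h1, h2]
  have RC : (c + c') * (b + b') = b * c + b * c' + c * b' + c' * b' := by
    rw [mul_add, (cc b).eq]; noncomm_ring
  rw [ha', one_mul] at S1
  rw [hBC, hCB, RK, RC]
  linear_combination (norm := skip) G3 + q⁻¹ • G1 - G5 + q • S1
  match_scalars <;> field_simp <;> ring

/-- `u a + (u a)⁻¹` -/
def symSum (a u : Rˣ) : R := ((u * a : Rˣ) : R) + (((u * a)⁻¹ : Rˣ) : R)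

theorem symSum_commute {a u : Rˣ} (ca : ∀ z, Commute ((a : R) + ((a⁻¹ : Rˣ) : R)) z)
    (cu : ∀ z, Commute ((u : R) + ((u⁻¹ : Rˣ) : R)) z) : Commute (symSum a u) (a : R) := by
  have := commute_of_central (Units.mul_inv a) (Units.inv_mul a) cu ca
  simpa [symSum] using this

theorem symSum_conj {a u : Rˣ} (ca : ∀ z, Commute ((a : R) + ((a⁻¹ : Rˣ) : R)) z)
    (cu : ∀ z, Commute ((u : R) + ((u⁻¹ : Rˣ) : R)) z) :
    symSum a (a⁻¹ * u * a) = symSum a u := by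
  symm
  refine conj_eq (Units.inv_mul a) (symSum_commute ca cu).units_inv_right ?_
  simp [symSum, mul_add, add_mul, mul_assoc]

theorem conj_central {a u : Rˣ} (cu : ∀ z, Commute ((u : R) + ((u⁻¹ : Rˣ) : R)) z) :
    ∀ z, Commute (((a⁻¹ * u * a : Rˣ) : R) + (((a⁻¹ * u * a)⁻¹ : Rˣ) : R)) z := by
  intro z
  have : ((a⁻¹ * u * a : Rˣ) : R) + (((a⁻¹ * u * a)⁻¹ : Rˣ) : R)
      = (u : R) + ((u⁻¹ : Rˣ) : R) := by
    symm
    refine conj_eq (Units.inv_mul a) (cu _) ?_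
    simp [mul_add, add_mul, mul_assoc]
  rw [this]; exact cu z

theorem aw_commute (q : Fˣ) (hq : (q : F) ^ 2 - ((q : F) ^ 2)⁻¹ ≠ 0) {a x b c : Rˣ}
    (ca : ∀ z, Commute ((a : R) + ((a⁻¹ : Rˣ) : R)) z)
    (cx : ∀ z, Commute ((x : R) + ((x⁻¹ : Rˣ) : R)) z)
    (cb : ∀ z, Commute ((b : R) + ((b⁻¹ : Rˣ) : R)) z)
    (cc : ∀ z, Commute ((c : R) + ((c⁻¹ : Rˣ) : R)) z)
    (h : (a * x * b * c : R) = algebraMap F R (q : F)⁻¹)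
    {z : R} (hz : Commute z (a : R)) :
    Commute (symSum a x + ((q : F) ^ 2 - ((q : F) ^ 2)⁻¹)⁻¹ •
      ((q : F) • (symSum a c * symSum a b) - (q : F)⁻¹ • (symSum a b * symSum a c))) z := by
  have q0 : (q : F) ≠ 0 := q.ne_zero
  have hx : (x : R) = (q : F)⁻¹ • (((a⁻¹ : Rˣ) : R) * ((c⁻¹ : Rˣ) : R) * ((b⁻¹ : Rˣ) : R)) := by
    have h1 : (x : R) = ((a⁻¹ : Rˣ) : R) * (a * x * b * c : R) * ((c⁻¹ : Rˣ) : R)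
        * ((b⁻¹ : Rˣ) : R) := by simp [mul_assoc]
    rw [h1, h, ← Algebra.commutes, mul_assoc, mul_assoc, Algebra.smul_def, mul_assoc]
  have hx' : ((x⁻¹ : Rˣ) : R) = (q : F) • ((b : R) * c * a) := by
    refine Units.inv_eq_of_mul_eq_one_right ?_
    rw [hx, smul_mul_smul_comm, inv_mul_cancel₀ q0, one_smul]
    simp [mul_assoc]
  have hA : symSum a x = (q : F)⁻¹ • (((c⁻¹ : Rˣ) : R) * ((b⁻¹ : Rˣ) : R))
      + (q : F) • ((b : R) * c) := by
    refine conj_eq (Units.mul_inv a) (symSum_commute ca cx) ?_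
    simp only [symSum, mul_inv_rev, Units.val_mul]
    rw [hx', hx]
    simp [mul_add, add_mul, mul_assoc]
  have cK : ∀ z, Commute ((q : F) • ((b : R) * c * a)
      + (q : F)⁻¹ • (((a⁻¹ : Rˣ) : R) * ((c⁻¹ : Rˣ) : R) * ((b⁻¹ : Rˣ) : R))) z := by
    intro z
    rw [← hx, ← hx', add_comm]
    exact cx z
  have key := aw_identity (q : F) q0 (Units.mul_inv a) (Units.inv_mul a)
    (Units.mul_inv b) (Units.inv_mul b) (Units.mul_inv c) (Units.inv_mul c) ca cb cc cK
  have e : symSum a x + ((q : F) ^ 2 - ((q : F) ^ 2)⁻¹)⁻¹ •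
      ((q : F) • (symSum a c * symSum a b) - (q : F)⁻¹ • (symSum a b * symSum a c))
      = ((q : F) ^ 2 - ((q : F) ^ 2)⁻¹)⁻¹ • (((q : F) - (q : F)⁻¹) •
        (((c : R) + ((c⁻¹ : Rˣ) : R)) * ((b : R) + ((b⁻¹ : Rˣ) : R)) +
      ((q : F) • ((b : R) * c * a)
      + (q : F)⁻¹ • (((a⁻¹ : Rˣ) : R) * ((c⁻¹ : Rˣ) : R) * ((b⁻¹ : Rˣ) : R)))
        * ((q : F) • ((a⁻¹ : Rˣ) : R) + (q : F)⁻¹ • (a : R)))) := by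
    rw [← key, hA]
    simp only [symSum, mul_inv_rev, Units.val_mul]
    rw [add_sub_assoc, smul_add (((q : F) ^ 2 - ((q : F) ^ 2)⁻¹)⁻¹), smul_smul, inv_mul_cancel₀ hq,
      one_smul]
  rw [e]
  have hz' : Commute (a : R) z := hz.symm
  have hz'' : Commute ((a⁻¹ : Rˣ) : R) z := hz'.units_inv_left
  refine Commute.smul_left (Commute.smul_left (Commute.add_left ?_ ?_) _) _
  · exact (cc z).mul_left (cb z)
  · exact (cK z).mul_left ((hz''.smul_left _).add_left (hz'.smul_left _))
end DAHAAux

namespace AWDAHA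

open DAHAAux

variable {F : Type*} [Field F]

/-- The generators `A, B, C`. -/
inductive AWGen : Type
  | A | B | C

/-- The three expressions that are required to be central, as elements of the free algebra:
`A + (q B C - q⁻¹ C B) / (q² - q⁻²)` and its two cyclic shifts. -/
def awExpr (q : Fˣ) : AWGen → FreeAlgebra F AWGen
  | .A => FreeAlgebra.ι F .A + ((q : F) ^ 2 - ((q : F) ^ 2)⁻¹)⁻¹ •
      ((q : F) • (FreeAlgebra.ι F .B * FreeAlgebra.ι F .C)
        - (q : F)⁻¹ • (FreeAlgebra.ι F .C * FreeAlgebra.ι F .B))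
  | .B => FreeAlgebra.ι F .B + ((q : F) ^ 2 - ((q : F) ^ 2)⁻¹)⁻¹ •
      ((q : F) • (FreeAlgebra.ι F .C * FreeAlgebra.ι F .A)
        - (q : F)⁻¹ • (FreeAlgebra.ι F .A * FreeAlgebra.ι F .C))
  | .C => FreeAlgebra.ι F .C + ((q : F) ^ 2 - ((q : F) ^ 2)⁻¹)⁻¹ •
      ((q : F) • (FreeAlgebra.ι F .A * FreeAlgebra.ι F .B)
        - (q : F)⁻¹ • (FreeAlgebra.ι F .B * FreeAlgebra.ι F .A))

/-- The defining relations: each of the three expressions commutes with `A`, `B` and `C`. -/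
inductive AWRel (q : Fˣ) : FreeAlgebra F AWGen → FreeAlgebra F AWGen → Prop
  | comm (g h : AWGen) :
      AWRel q (awExpr q g * FreeAlgebra.ι F h) (FreeAlgebra.ι F h * awExpr q g)

/-- The universal Askey-Wilson algebra `△_q`. -/
abbrev UAW (q : Fˣ) : Type _ := RingQuot (AWRel q)

/-- The generators `A, B, C` of `△_q`. -/
def UAW.gen (q : Fˣ) (g : AWGen) : UAW q := RingQuot.mkAlgHom F (AWRel q) (FreeAlgebra.ι F g)

/-- The generators `t_i` and `t_i⁻¹`, `i = 0, 1, 2, 3`. -/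
inductive DAHAGen : Type
  | t (i : ZMod 4) | tInv (i : ZMod 4)

/-- The defining relations of the universal DAHA of type `(C₁^∨, C₁)`. -/
inductive DAHARel (q : Fˣ) : FreeAlgebra F DAHAGen → FreeAlgebra F DAHAGen → Prop
  | mul_inv (i : ZMod 4) :
      DAHARel q (FreeAlgebra.ι F (.t i) * FreeAlgebra.ι F (.tInv i)) 1
  | inv_mul (i : ZMod 4) :
      DAHARel q (FreeAlgebra.ι F (.tInv i) * FreeAlgebra.ι F (.t i)) 1
  | central (i : ZMod 4) (g : DAHAGen) :
      DAHARel q ((FreeAlgebra.ι F (.t i) + FreeAlgebra.ι F (.tInv i)) * FreeAlgebra.ι F g)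
        (FreeAlgebra.ι F g * (FreeAlgebra.ι F (.t i) + FreeAlgebra.ι F (.tInv i)))
  | prod :
      DAHARel q (FreeAlgebra.ι F (.t 0) * FreeAlgebra.ι F (.t 1) * FreeAlgebra.ι F (.t 2)
        * FreeAlgebra.ι F (.t 3)) (algebraMap F _ (q : F)⁻¹)

/-- The universal DAHA `ℌ_q` of type `(C₁^∨, C₁)`. -/
abbrev DAHA (q : Fˣ) : Type _ := RingQuot (DAHARel q)

namespace DAHA

/-- The generator `t_i` of `ℌ_q`, as an invertible element whose inverse is the generator
`t_i⁻¹`. -/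
def t (q : Fˣ) (i : ZMod 4) : (DAHA q)ˣ where
  val := RingQuot.mkAlgHom F (DAHARel q) (FreeAlgebra.ι F (.t i))
  inv := RingQuot.mkAlgHom F (DAHARel q) (FreeAlgebra.ι F (.tInv i))
  val_inv := by
    rw [← map_mul, RingQuot.mkAlgHom_rel F (DAHARel.mul_inv i), map_one]
  inv_val := by
    rw [← map_mul, RingQuot.mkAlgHom_rel F (DAHARel.inv_mul i), map_one]

/-- An element commuting with all generators is central. -/
theorem commute_of_gen (q : Fˣ) (x : DAHA q)
    (h : ∀ g, Commute x (RingQuot.mkAlgHom F (DAHARel q) (FreeAlgebra.ι F g))) (z : DAHA q) :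
    Commute x z := by
  obtain ⟨y, rfl⟩ := RingQuot.mkAlgHom_surjective F (DAHARel q) z
  induction y using FreeAlgebra.induction with
  | grade0 r => rw [AlgHom.commutes]; exact (Algebra.commutes r x).symm
  | grade1 g => exact h g
  | mul a b ha hb => rw [map_mul]; exact ha.mul_right hb
  | add a b ha hb => rw [map_add]; exact ha.add_right hb

theorem central (q : Fˣ) (i : ZMod 4) (z : DAHA q) :
    Commute ((t q i : DAHA q) + ((t q i)⁻¹ : (DAHA q)ˣ)) z := by
  refine commute_of_gen q _ (fun g => ?_) z
  have := RingQuot.mkAlgHom_rel F (DAHARel.central (q := q) i g)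
  simp only [map_mul, map_add] at this
  exact this

theorem prod0 (q : Fˣ) : (t q 0 * t q 1 * t q 2 * t q 3 : DAHA q)
    = algebraMap F (DAHA q) (q : F)⁻¹ := by
  have := RingQuot.mkAlgHom_rel F (DAHARel.prod (q := q))
  simp only [map_mul, AlgHom.commutes] at this
  exact this

theorem prod_cyc {R : Type*} [Ring R] [Algebra F R] {r : F} {a b c d : R} (a' : R)
    (h1 : a' * a = 1)
    (h : a * b * c * d = algebraMap F R r) : b * c * d * a = algebraMap F R r := by
  have : b * c * d = a' * algebraMap F R r := by
    rw [← h]; simp only [← mul_assoc, h1, one_mul]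
  rw [this, ← Algebra.commutes, mul_assoc, h1, mul_one]

theorem prod1 (q : Fˣ) : (t q 1 * t q 2 * t q 3 * t q 0 : DAHA q)
    = algebraMap F (DAHA q) (q : F)⁻¹ :=
  prod_cyc _ (Units.inv_mul (t q 0)) (prod0 q)

theorem prod2 (q : Fˣ) : (t q 2 * t q 3 * t q 0 * t q 1 : DAHA q)
    = algebraMap F (DAHA q) (q : F)⁻¹ :=
  prod_cyc _ (Units.inv_mul (t q 1)) (prod1 q)

theorem prod3 (q : Fˣ) : (t q 3 * t q 0 * t q 1 * t q 2 : DAHA q)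
    = algebraMap F (DAHA q) (q : F)⁻¹ :=
  prod_cyc _ (Units.inv_mul (t q 2)) (prod2 q)

/-- The algebra homomorphism out of `ℌ_q` given by the images `t i`, `s i` of the generators `t_i`,
`t_i⁻¹`. -/
def lift (q : Fˣ) {R : Type*} [Ring R] [Algebra F R] (t s : ZMod 4 → R)
    (hts : ∀ i, t i * s i = 1) (hst : ∀ i, s i * t i = 1)
    (hc : ∀ i z, Commute (t i + s i) z)
    (hp : t 0 * t 1 * t 2 * t 3 = algebraMap F R (q : F)⁻¹) : DAHA q →ₐ[F] R :=
  RingQuot.liftAlgHom F ⟨FreeAlgebra.lift F (fun g => match g with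
    | .t i => t i
    | .tInv i => s i), by
      intro x y h
      cases h with
      | mul_inv i => simpa using hts i
      | inv_mul i => simpa using hst i
      | central i g => simpa using (hc i _).eq
      | prod => simpa using hp⟩

theorem lift_t (q : Fˣ) {R : Type*} [Ring R] [Algebra F R] (t' s : ZMod 4 → R)
    (hts : ∀ i, t' i * s i = 1) (hst : ∀ i, s i * t' i = 1)
    (hc : ∀ i z, Commute (t' i + s i) z)
    (hp : t' 0 * t' 1 * t' 2 * t' 3 = algebraMap F R (q : F)⁻¹) (i : ZMod 4) :
    lift q t' s hts hst hc hp (t q i) = t' i := by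
  simp [lift, t]

theorem lift_t_inv (q : Fˣ) {R : Type*} [Ring R] [Algebra F R] (t' s : ZMod 4 → R)
    (hts : ∀ i, t' i * s i = 1) (hst : ∀ i, s i * t' i = 1)
    (hc : ∀ i z, Commute (t' i + s i) z)
    (hp : t' 0 * t' 1 * t' 2 * t' 3 = algebraMap F R (q : F)⁻¹) (i : ZMod 4) :
    lift q t' s hts hst hc hp ((t q i)⁻¹ : (DAHA q)ˣ) = s i := by
  have : (((t q i)⁻¹ : (DAHA q)ˣ) : DAHA q)
    = RingQuot.mkAlgHom F (DAHARel q) (FreeAlgebra.ι F (.tInv i)) := rfl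
  simp [lift, this]

/-- The endomorphism of `ℌ_q` that sends `t_i` to `t_{i+j}` for every `i` (indices modulo `4`). -/
def shiftHom (q : Fˣ) (j : ZMod 4) : DAHA q →ₐ[F] DAHA q :=
  lift q (fun i => (t q (i + j) : DAHA q)) (fun i => (((t q (i + j))⁻¹ : (DAHA q)ˣ) : DAHA q))
    (fun _ => Units.mul_inv _) (fun _ => Units.inv_mul _) (fun i => central q (i + j)) (by
      have hj : j = 0 ∨ j = 1 ∨ j = 2 ∨ j = 3 := by revert j; decide
      rcases hj with rfl | rfl | rfl | rfl
      · exact prod0 q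
      · exact prod1 q
      · exact prod2 q
      · exact prod3 q)

theorem shiftHom_comp (q : Fˣ) {j l : ZMod 4} (h : j + l = 0) :
    (shiftHom q j).comp (shiftHom q l) = AlgHom.id F (DAHA q) := by
  apply RingQuot.ringQuot_ext'
  apply FreeAlgebra.hom_ext
  funext g
  cases g with
  | t i =>
    change shiftHom q j (shiftHom q l (t q i)) = t q i
    rw [shiftHom, shiftHom, lift_t, lift_t, add_assoc, add_comm l j, h, add_zero]
  | tInv i =>
    change shiftHom q j (shiftHom q l ((t q i)⁻¹ : (DAHA q)ˣ)) = ((t q i)⁻¹ : (DAHA q)ˣ)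
    rw [shiftHom, shiftHom, lift_t_inv, lift_t_inv, add_assoc, add_comm l j, h, add_zero]

/-- The action of `ℤ/4ℤ` on `ℌ_q` by algebra automorphisms: the class of `j` acts by
`t_i ↦ t_{i+j}` for every `i` (indices modulo `4`). -/
def shift (q : Fˣ) (j : ZMod 4) : DAHA q ≃ₐ[F] DAHA q :=
  AlgEquiv.ofAlgHom (shiftHom q j) (shiftHom q (-j))
    (shiftHom_comp q (add_neg_cancel j)) (shiftHom_comp q (neg_add_cancel j))

end DAHA

theorem q_ne (q : Fˣ) (hq : ¬ IsOfFinOrder q) : (q : F) ^ 2 - ((q : F) ^ 2)⁻¹ ≠ 0 := by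
  intro h
  apply hq
  rw [isOfFinOrder_iff_pow_eq_one]
  refine ⟨4, by norm_num, ?_⟩
  ext
  have q0 : (q : F) ≠ 0 := q.ne_zero
  rw [sub_eq_zero] at h
  field_simp at h
  push_cast
  linear_combination h

/-- The images of the generators under `ζ`: `A ↦ t₁t₀ + (t₁t₀)⁻¹`, `B ↦ t₃t₀ + (t₃t₀)⁻¹`,
`C ↦ t₂t₀ + (t₂t₀)⁻¹`. -/
def zetaGen (q : Fˣ) : AWGen → DAHA q
  | .A => ((DAHA.t q 1 * DAHA.t q 0 : (DAHA q)ˣ) : DAHA q)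
      + ((DAHA.t q 1 * DAHA.t q 0)⁻¹ : (DAHA q)ˣ)
  | .B => ((DAHA.t q 3 * DAHA.t q 0 : (DAHA q)ˣ) : DAHA q)
      + ((DAHA.t q 3 * DAHA.t q 0)⁻¹ : (DAHA q)ˣ)
  | .C => ((DAHA.t q 2 * DAHA.t q 0 : (DAHA q)ˣ) : DAHA q)
      + ((DAHA.t q 2 * DAHA.t q 0)⁻¹ : (DAHA q)ˣ)

theorem zetaGen_commute (q : Fˣ) (g : AWGen) : Commute (zetaGen q g) (DAHA.t q 0 : DAHA q) := by
  cases g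
  · exact symSum_commute (DAHA.central q 0) (DAHA.central q 1)
  · exact symSum_commute (DAHA.central q 0) (DAHA.central q 3)
  · exact symSum_commute (DAHA.central q 0) (DAHA.central q 2)

/-- The homomorphism `ζ : △_q → ℌ_q`. -/
def zeta (q : Fˣ) (hq : ¬ IsOfFinOrder q) : UAW q →ₐ[F] DAHA q :=
  RingQuot.liftAlgHom F ⟨FreeAlgebra.lift F (zetaGen q), by
    intro x y h
    obtain ⟨g, h⟩ := h
    rw [map_mul, map_mul, FreeAlgebra.lift_ι_apply]
    have hz := zetaGen_commute q h
    have c := DAHA.central q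
    have i0 := Units.mul_inv (DAHA.t q 0)
    cases g
    · have := aw_commute q (q_ne q hq) (c 0) (c 1) (c 2) (c 3) (DAHA.prod0 q) hz
      simp only [awExpr, map_add, map_sub, map_smul, map_mul, FreeAlgebra.lift_ι_apply]
      exact this.eq
    · have := aw_commute q (q_ne q hq) (c 0) (conj_central (a := DAHA.t q 0) (c 3)) (c 1) (c 2)
        (by
          rw [← DAHA.prod3 q]
          simp only [Units.val_mul, ← mul_assoc, i0, one_mul]) hz
      rw [symSum_conj (c 0) (c 3)] at this
      simp only [awExpr, map_add, map_sub, map_smul, map_mul, FreeAlgebra.lift_ι_apply]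
      exact this.eq
    · have := aw_commute q (q_ne q hq) (c 0) (conj_central (a := DAHA.t q 0) (c 2))
        (conj_central (a := DAHA.t q 0) (c 3)) (c 1)
        (by
          rw [← DAHA.prod2 q]
          simp only [Units.val_mul, ← mul_assoc, i0, one_mul]
          rw [mul_assoc _ (DAHA.t q 0 : DAHA q) (((DAHA.t q 0)⁻¹ : (DAHA q)ˣ) : DAHA q), i0,
            mul_one]) hz
      rw [symSum_conj (c 0) (c 3), symSum_conj (c 0) (c 2)] at this
      simp only [awExpr, map_add, map_sub, map_smul, map_mul, FreeAlgebra.lift_ι_apply]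
      exact this.eq⟩

theorem zeta_gen (q : Fˣ) (hq : ¬ IsOfFinOrder q) (g : AWGen) :
    zeta q hq (UAW.gen q g) = zetaGen q g := by
  simp [zeta, UAW.gen]

theorem zeta_commute (q : Fˣ) (hq : ¬ IsOfFinOrder q) (x : UAW q) :
    Commute (zeta q hq x) (DAHA.t q 0 : DAHA q) := by
  obtain ⟨y, rfl⟩ := RingQuot.mkAlgHom_surjective F (AWRel q) x
  induction y using FreeAlgebra.induction with
  | grade0 r => rw [AlgHom.commutes, AlgHom.commutes]; exact Algebra.commutes r _
  | grade1 g =>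
    have := zetaGen_commute q g
    rw [← zeta_gen q hq] at this
    exact this
  | mul a b ha hb => rw [map_mul, map_mul]; exact ha.mul_left hb
  | add a b ha hb => rw [map_add, map_add]; exact ha.add_left hb

/-- The pullback of a `B`-module `V` along an algebra homomorphism `f : A → B`: the same abelian
group, on which `x : A` acts as `f x`. -/
def Pullback {A B : Type*} [Ring A] [Ring B] [Algebra F A] [Algebra F B] (_f : A →ₐ[F] B)
    (V : Type*) : Type _ := V

section
variable {A B : Type*} [Ring A] [Ring B] [Algebra F A] [Algebra F B] (f : A →ₐ[F] B)
  (V : Type*) [AddCommGroup V]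

instance Pullback.instAddCommGroup : AddCommGroup (Pullback f V) :=
  inferInstanceAs (AddCommGroup V)

instance Pullback.instModule [Module B V] : Module A (Pullback f V) :=
  Module.compHom V f.toRingHom

end

theorem eigen_add (q : Fˣ) (V : Type*) [AddCommGroup V] [Module (DAHA q) V] (θ : F) {v w : V}
    (hv : (DAHA.t q 0 : DAHA q) • v = algebraMap F (DAHA q) θ • v)
    (hw : (DAHA.t q 0 : DAHA q) • w = algebraMap F (DAHA q) θ • w) :
    (DAHA.t q 0 : DAHA q) • (v + w) = algebraMap F (DAHA q) θ • (v + w) := by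
  rw [smul_add, smul_add, hv, hw]

theorem eigen_smul (q : Fˣ) (hq : ¬ IsOfFinOrder q) (V : Type*) [AddCommGroup V]
    [Module (DAHA q) V] (θ : F) (x : UAW q) {v : V}
    (hv : (DAHA.t q 0 : DAHA q) • v = algebraMap F (DAHA q) θ • v) :
    (DAHA.t q 0 : DAHA q) • (zeta q hq x • v) = algebraMap F (DAHA q) θ • (zeta q hq x • v) := by
  rw [← mul_smul, ← mul_smul, ← (zeta_commute q hq x).eq, Algebra.commutes, mul_smul, mul_smul, hv]

/-- The eigenspace `V(θ) = {v ∈ V | t₀ v = θ v}` of `t₀` on an `ℌ_q`-module `V`, as a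
`△_q`-submodule of `V`. -/
def t0Eigenspace (q : Fˣ) (hq : ¬ IsOfFinOrder q) (V : Type*) [AddCommGroup V]
    [Module (DAHA q) V] (θ : F) : Submodule (UAW q) (Pullback (zeta q hq) V) where
  carrier := {v : V | (DAHA.t q 0 : DAHA q) • v = algebraMap F (DAHA q) θ • v}
  zero_mem' := (smul_zero (A := V) _).trans (smul_zero (A := V) _).symm
  add_mem' hv hw := eigen_add q V θ hv hw
  smul_mem' x _ hv := eigen_smul q hq V θ x hv

/-! ### The module `E(k₀, k₁, k₂, k₃)` -/

section E

/-- The basis vector `v_n` of `F^{d+1}`, `0 ≤ n ≤ d`. -/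
def vec (d n : ℕ) : Fin (d + 1) → F := fun j => if (j : ℕ) = n then 1 else 0

/-- `t₀ v_i` in `E(k₀, k₁, k₂, k₃)`. -/
def tE0 (q k₀ : F) (d i : ℕ) : Fin (d + 1) → F :=
  if i = 0 then k₀ • vec d 0
  else if i = d then k₀ • vec d d
  else if Even i then
    (k₀⁻¹ * (q ^ i)⁻¹ * (1 - q ^ i) * (1 - k₀ ^ 2 * q ^ i)) • vec d (i - 1)
      + (k₀ + k₀⁻¹ - k₀⁻¹ * (q ^ i)⁻¹) • vec d i
  else (k₀⁻¹ * (q ^ (i + 1))⁻¹) • (vec d i - vec d (i + 1))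

/-- `t₁ v_i` in `E(k₀, k₁, k₂, k₃)`. -/
def tE1 (q k₀ k₁ : F) (d i : ℕ) : Fin (d + 1) → F :=
  if i = 0 then k₁ • vec d 0 + k₁⁻¹ • vec d 1
  else if Even i then
    -(k₁ * (1 - q ^ i) * (1 - k₀ ^ 2 * q ^ i)) • vec d (i - 1)
      + k₁ • vec d i + k₁⁻¹ • vec d (i + 1)
  else k₁⁻¹ • vec d i

/-- `t₂ v_i` in `E(k₀, k₁, k₂, k₃)`. -/
def tE2 (q k₀ k₁ k₂ k₃ : F) (d i : ℕ) : Fin (d + 1) → F :=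
  if Even i then (k₀⁻¹ * k₁⁻¹ * k₃⁻¹ * (q ^ (i + 1))⁻¹) • (vec d i - vec d (i + 1))
  else
    ((k₀ * k₁ * k₃ * q ^ i - k₂) * (k₀ * k₁ * k₃ * q ^ i - k₂⁻¹) / (k₀ * k₁ * k₃ * q ^ i))
        • vec d (i - 1)
      + (k₂ + k₂⁻¹ - k₀⁻¹ * k₁⁻¹ * k₃⁻¹ * (q ^ i)⁻¹) • vec d i

/-- `t₃ v_i` in `E(k₀, k₁, k₂, k₃)`. -/
def tE3 (q k₀ k₁ k₂ k₃ : F) (d i : ℕ) : Fin (d + 1) → F :=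
  if Even i then k₃ • vec d i
  else if i = d then
    -(k₃⁻¹ * (k₀ * k₁ * k₃ * q ^ d - k₂) * (k₀ * k₁ * k₃ * q ^ d - k₂⁻¹)) • vec d (d - 1)
      + k₃⁻¹ • vec d d
  else
    -(k₃⁻¹ * (k₀ * k₁ * k₃ * q ^ i - k₂) * (k₀ * k₁ * k₃ * q ^ i - k₂⁻¹)) • vec d (i - 1)
      + k₃⁻¹ • vec d i + k₃ • vec d (i + 1)

/-- The endomorphism of `F^{d+1}` with `v_i ↦ f i` for `0 ≤ i ≤ d`. -/
noncomputable def ofImages (d : ℕ) (f : ℕ → Fin (d + 1) → F) : Module.End F (Fin (d + 1) → F) :=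
  (Pi.basisFun F (Fin (d + 1))).constr F (fun i => f i)

/-- The operators by which `t₀, t₁, t₂, t₃` act on `E(k₀, k₁, k₂, k₃)`. -/
noncomputable def tE (q k₀ k₁ k₂ k₃ : F) (d : ℕ) : ZMod 4 → Module.End F (Fin (d + 1) → F) :=
  ![ofImages d (tE0 q k₀ d), ofImages d (tE1 q k₀ k₁ d), ofImages d (tE2 q k₀ k₁ k₂ k₃ d),
    ofImages d (tE3 q k₀ k₁ k₂ k₃ d)]

theorem vec_eq (d : ℕ) (i : Fin (d + 1)) : (vec d i : Fin (d + 1) → F) = Pi.basisFun F _ i := by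
  funext j
  simp [vec, Pi.single_apply, Fin.ext_iff]

theorem vec_big {d n : ℕ} (h : d < n) : (vec d n : Fin (d + 1) → F) = 0 := by
  funext j
  have := j.2
  simp only [vec, Pi.zero_apply, ite_eq_right_iff]
  omega

theorem ofImages_vec {d n : ℕ} (f : ℕ → Fin (d + 1) → F) (h : n ≤ d) :
    ofImages d f (vec d n) = f n := by
  have := vec_eq (F := F) d ⟨n, by omega⟩
  simp only at this
  rw [this, ofImages, Module.Basis.constr_basis]

theorem ext_vec {d : ℕ} {f g : Module.End F (Fin (d + 1) → F)}
    (h0 : f (vec d 0) = g (vec d 0))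
    (h1 : ∀ m, f (vec d (2 * m + 1)) = g (vec d (2 * m + 1)))
    (h2 : ∀ m, f (vec d (2 * m + 2)) = g (vec d (2 * m + 2))) : f = g := by
  refine (Pi.basisFun F (Fin (d + 1))).ext fun i => ?_
  rw [← vec_eq]
  obtain ⟨m, hm | hm⟩ := Nat.even_or_odd' (i : ℕ)
  · rcases m with _ | m
    · rw [hm]; exact h0
    · rw [hm]; exact h2 m
  · rw [hm]; exact h1 m

variable {q k₀ k₁ k₂ k₃ : F} {d : ℕ}

theorem tE0_zero : ofImages d (tE0 q k₀ d) (vec d 0) = k₀ • vec d 0 := by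
  rw [ofImages_vec _ (Nat.zero_le _)]; simp [tE0]

theorem tE0_odd (hq : q ≠ 0) (h₀ : k₀ ≠ 0) (hk : k₀ ^ 2 * q ^ (d + 1) = 1) (m : ℕ) :
    ofImages d (tE0 q k₀ d) (vec d (2 * m + 1)) =
      (k₀⁻¹ * (q ^ (2 * m) * q ^ 2)⁻¹) • (vec d (2 * m + 1) - vec d (2 * m + 2)) := by
  rcases lt_or_ge d (2 * m + 1) with h | h
  · rw [vec_big h, vec_big (n := 2 * m + 2) (by omega)]; simp
  · rw [ofImages_vec _ h, tE0, if_neg (by omega)]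
    split_ifs with h1 h2
    · rw [vec_big (n := 2 * m + 2) (by omega), ← h1, sub_zero]
      congr 1
      rw [← h1] at hk
      rw [← pow_add]
      field_simp
      exact hk
    · exact absurd h2 (by simp)
    · rw [← pow_add]

theorem tE0_even (hd : Odd d) (hk : k₀ ^ 2 * q ^ (d + 1) = 1) (m : ℕ) :
    ofImages d (tE0 q k₀ d) (vec d (2 * m + 2)) =
      (k₀⁻¹ * (q ^ (2 * m) * q ^ 2)⁻¹ * (1 - q ^ (2 * m) * q ^ 2)
        * (1 - k₀ ^ 2 * (q ^ (2 * m) * q ^ 2))) • vec d (2 * m + 1)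
      + (k₀ + k₀⁻¹ - k₀⁻¹ * (q ^ (2 * m) * q ^ 2)⁻¹) • vec d (2 * m + 2) := by
  obtain ⟨e, he⟩ := hd
  rcases lt_or_ge d (2 * m + 2) with h | h
  · rw [vec_big h]
    rcases lt_or_ge d (2 * m + 1) with h' | h'
    · rw [vec_big h']; simp
    · have : d + 1 = 2 * m + 2 := by omega
      rw [← pow_add, ← this, hk]; simp
  · rw [ofImages_vec _ h, tE0, if_neg (by omega), if_neg (by omega),
      if_pos ⟨m + 1, by ring⟩, ← pow_add]
    rfl

theorem tE1_zero : ofImages d (tE1 q k₀ k₁ d) (vec d 0) = k₁ • vec d 0 + k₁⁻¹ • vec d 1 := by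
  rw [ofImages_vec _ (Nat.zero_le _)]; simp [tE1]

theorem tE1_odd (m : ℕ) :
    ofImages d (tE1 q k₀ k₁ d) (vec d (2 * m + 1)) = k₁⁻¹ • vec d (2 * m + 1) := by
  rcases lt_or_ge d (2 * m + 1) with h | h
  · rw [vec_big h]; simp
  · rw [ofImages_vec _ h, tE1, if_neg (by omega), if_neg (by simp)]

theorem tE1_even (hd : Odd d) (hk : k₀ ^ 2 * q ^ (d + 1) = 1) (m : ℕ) :
    ofImages d (tE1 q k₀ k₁ d) (vec d (2 * m + 2)) =
      -(k₁ * (1 - q ^ (2 * m) * q ^ 2) * (1 - k₀ ^ 2 * (q ^ (2 * m) * q ^ 2))) • vec d (2 * m + 1)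
      + k₁ • vec d (2 * m + 2) + k₁⁻¹ • vec d (2 * m + 3) := by
  obtain ⟨e, he⟩ := hd
  rcases lt_or_ge d (2 * m + 2) with h | h
  · rw [vec_big h, vec_big (n := 2 * m + 3) (by omega)]
    rcases lt_or_ge d (2 * m + 1) with h' | h'
    · rw [vec_big h']; simp
    · have : d + 1 = 2 * m + 2 := by omega
      rw [← pow_add, ← this, hk]; simp
  · rw [ofImages_vec _ h, tE1, if_neg (by omega), if_pos ⟨m + 1, by ring⟩, ← pow_add]
    rfl

theorem tE2_even (hd : Odd d) (m : ℕ) :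
    ofImages d (tE2 q k₀ k₁ k₂ k₃ d) (vec d (2 * m)) =
      (k₀⁻¹ * k₁⁻¹ * k₃⁻¹ * (q ^ (2 * m) * q)⁻¹) • (vec d (2 * m) - vec d (2 * m + 1)) := by
  obtain ⟨e, he⟩ := hd
  rcases lt_or_ge d (2 * m) with h | h
  · rw [vec_big h, vec_big (n := 2 * m + 1) (by omega)]; simp
  · rw [ofImages_vec _ h, tE2, if_pos (by simp), ← pow_succ]

theorem tE2_odd (hd : Odd d) (m : ℕ) :
    ofImages d (tE2 q k₀ k₁ k₂ k₃ d) (vec d (2 * m + 1)) =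
      ((k₀ * k₁ * k₃ * (q ^ (2 * m) * q) - k₂) * (k₀ * k₁ * k₃ * (q ^ (2 * m) * q) - k₂⁻¹)
        / (k₀ * k₁ * k₃ * (q ^ (2 * m) * q))) • vec d (2 * m)
      + (k₂ + k₂⁻¹ - k₀⁻¹ * k₁⁻¹ * k₃⁻¹ * (q ^ (2 * m) * q)⁻¹) • vec d (2 * m + 1) := by
  obtain ⟨e, he⟩ := hd
  rcases lt_or_ge d (2 * m + 1) with h | h
  · rw [vec_big h, vec_big (n := 2 * m) (by omega)]; simp
  · rw [ofImages_vec _ h, tE2, if_neg (by simp), ← pow_succ]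
    rfl

theorem tE3_even (m : ℕ) :
    ofImages d (tE3 q k₀ k₁ k₂ k₃ d) (vec d (2 * m)) = k₃ • vec d (2 * m) := by
  rcases lt_or_ge d (2 * m) with h | h
  · rw [vec_big h]; simp
  · rw [ofImages_vec _ h, tE3, if_pos (by simp)]

theorem tE3_odd (hd : Odd d) (m : ℕ) :
    ofImages d (tE3 q k₀ k₁ k₂ k₃ d) (vec d (2 * m + 1)) =
      -(k₃⁻¹ * (k₀ * k₁ * k₃ * (q ^ (2 * m) * q) - k₂) * (k₀ * k₁ * k₃ * (q ^ (2 * m) * q) - k₂⁻¹))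
        • vec d (2 * m) + k₃⁻¹ • vec d (2 * m + 1) + k₃ • vec d (2 * m + 2) := by
  obtain ⟨e, he⟩ := hd
  rcases lt_or_ge d (2 * m + 1) with h | h
  · rw [vec_big h, vec_big (n := 2 * m) (by omega), vec_big (n := 2 * m + 2) (by omega)]; simp
  · rw [ofImages_vec _ h, tE3, if_neg (by simp), ← pow_succ]
    split_ifs with h1
    · rw [vec_big (n := 2 * m + 2) (by omega), smul_zero, add_zero, ← h1]
      rfl
    · rfl

/-- The operators `c_i - t_i`, with `c_i = k_i + k_i⁻¹`. -/
noncomputable def sE (q k₀ k₁ k₂ k₃ : F) (d : ℕ) (i : ZMod 4) : Module.End F (Fin (d + 1) → F) :=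
  ((![k₀, k₁, k₂, k₃] : ZMod 4 → F) i + ((![k₀, k₁, k₂, k₃] : ZMod 4 → F) i)⁻¹) • 1
    - tE q k₀ k₁ k₂ k₃ d i

theorem tE_mul_sE (hd : Odd d) (hq : q ≠ 0) (h₀ : k₀ ≠ 0) (h₁ : k₁ ≠ 0) (h₂ : k₂ ≠ 0)
    (h₃ : k₃ ≠ 0) (hk : k₀ ^ 2 * q ^ (d + 1) = 1) (i : ZMod 4) :
    tE q k₀ k₁ k₂ k₃ d i * sE q k₀ k₁ k₂ k₃ d i = 1 := by
  have hp : ∀ m : ℕ, q ^ (2 * m) ≠ 0 := fun m => pow_ne_zero _ hq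
  have hi : i = 0 ∨ i = 1 ∨ i = 2 ∨ i = 3 := by revert i; decide
  rcases hi with rfl | rfl | rfl | rfl
  · change ofImages d (tE0 q k₀ d) * ((k₀ + k₀⁻¹) • (1 : Module.End F (Fin (d + 1) → F)) - ofImages d (tE0 q k₀ d)) = 1
    refine ext_vec ?_ (fun m => ?_) (fun m => ?_) <;>
    simp only [Module.End.mul_apply, LinearMap.sub_apply, LinearMap.smul_apply, map_sub,
      map_add, map_smul, tE0_zero, tE0_odd hq h₀ hk, tE0_even hd hk, Module.End.one_apply]
    · match_scalars; field_simp; ring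
    · have := hp m
      generalize q ^ (2 * m) = p at *
      match_scalars <;> field_simp <;> ring
    · have := hp m
      generalize q ^ (2 * m) = p at *
      match_scalars <;> field_simp <;> ring
  · change ofImages d (tE1 q k₀ k₁ d) * ((k₁ + k₁⁻¹) • (1 : Module.End F (Fin (d + 1) → F)) - ofImages d (tE1 q k₀ k₁ d)) = 1
    have h01 := tE1_odd (q := q) (k₀ := k₀) (k₁ := k₁) (d := d) 0
    have h03 : ∀ m, ofImages d (tE1 q k₀ k₁ d) (vec d (2 * m + 3)) = k₁⁻¹ • vec d (2 * m + 3) :=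
      fun m => tE1_odd (m + 1)
    rw [mul_zero, zero_add] at h01
    refine ext_vec ?_ (fun m => ?_) (fun m => ?_) <;>
    simp only [Module.End.mul_apply, LinearMap.sub_apply, LinearMap.smul_apply, map_sub,
      map_add, map_smul, tE1_zero, tE1_odd, tE1_even hd hk, h01, h03, Module.End.one_apply]
    · match_scalars <;> field_simp <;> ring
    · match_scalars <;> field_simp <;> ring
    · have := hp m
      generalize q ^ (2 * m) = p at *
      match_scalars <;> field_simp <;> ring
  · change ofImages d (tE2 q k₀ k₁ k₂ k₃ d) *
      ((k₂ + k₂⁻¹) • (1 : Module.End F (Fin (d + 1) → F)) - ofImages d (tE2 q k₀ k₁ k₂ k₃ d)) = 1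
    have he : ∀ m, (ofImages d (tE2 q k₀ k₁ k₂ k₃ d) *
      ((k₂ + k₂⁻¹) • (1 : Module.End F (Fin (d + 1) → F)) - ofImages d (tE2 q k₀ k₁ k₂ k₃ d))) (vec d (2 * m))
        = (1 : Module.End F _) (vec d (2 * m)) := by
      intro m
      simp only [Module.End.mul_apply, LinearMap.sub_apply, LinearMap.smul_apply, map_sub,
        map_add, map_smul, tE2_odd hd, tE2_even hd, Module.End.one_apply]
      have := hp m
      generalize q ^ (2 * m) = p at *
      match_scalars <;> field_simp <;> ring
    refine ext_vec (he 0) (fun m => ?_) (fun m => he (m + 1))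
    simp only [Module.End.mul_apply, LinearMap.sub_apply, LinearMap.smul_apply, map_sub,
      map_add, map_smul, tE2_odd hd, tE2_even hd, Module.End.one_apply]
    have := hp m
    generalize q ^ (2 * m) = p at *
    match_scalars <;> field_simp <;> ring
  · change ofImages d (tE3 q k₀ k₁ k₂ k₃ d) *
      ((k₃ + k₃⁻¹) • (1 : Module.End F (Fin (d + 1) → F)) - ofImages d (tE3 q k₀ k₁ k₂ k₃ d)) = 1
    have he : ∀ m, (ofImages d (tE3 q k₀ k₁ k₂ k₃ d) *
      ((k₃ + k₃⁻¹) • (1 : Module.End F (Fin (d + 1) → F)) - ofImages d (tE3 q k₀ k₁ k₂ k₃ d))) (vec d (2 * m))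
        = (1 : Module.End F _) (vec d (2 * m)) := by
      intro m
      simp only [Module.End.mul_apply, LinearMap.sub_apply, LinearMap.smul_apply, map_sub,
        map_smul, tE3_even, Module.End.one_apply]
      match_scalars; field_simp; ring
    have h02 : ∀ m, ofImages d (tE3 q k₀ k₁ k₂ k₃ d) (vec d (2 * m + 2)) = k₃ • vec d (2 * m + 2) :=
      fun m => tE3_even (m + 1)
    refine ext_vec (he 0) (fun m => ?_) (fun m => he (m + 1))
    simp only [Module.End.mul_apply, LinearMap.sub_apply, LinearMap.smul_apply, map_sub,
      map_add, map_smul, tE3_odd hd, tE3_even, h02, Module.End.one_apply]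
    have := hp m
    generalize q ^ (2 * m) = p at *
    match_scalars <;> field_simp <;> ring

theorem tE_sE_comm (i : ZMod 4) :
    sE q k₀ k₁ k₂ k₃ d i * tE q k₀ k₁ k₂ k₃ d i = tE q k₀ k₁ k₂ k₃ d i * sE q k₀ k₁ k₂ k₃ d i := by
  rw [sE, sub_mul, mul_sub, smul_mul_assoc, mul_smul_comm, one_mul, mul_one]

theorem tE_prod (hd : Odd d) (hq : q ≠ 0) (h₀ : k₀ ≠ 0) (h₁ : k₁ ≠ 0) (h₂ : k₂ ≠ 0)
    (h₃ : k₃ ≠ 0) (hk : k₀ ^ 2 * q ^ (d + 1) = 1) :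
    tE q k₀ k₁ k₂ k₃ d 0 * tE q k₀ k₁ k₂ k₃ d 1 * tE q k₀ k₁ k₂ k₃ d 2 * tE q k₀ k₁ k₂ k₃ d 3
      = algebraMap F _ q⁻¹ := by
  have hp : ∀ m : ℕ, q ^ (2 * m) ≠ 0 := fun m => pow_ne_zero _ hq
  have key : tE q k₀ k₁ k₂ k₃ d 2 * tE q k₀ k₁ k₂ k₃ d 3
      = q⁻¹ • (sE q k₀ k₁ k₂ k₃ d 1 * sE q k₀ k₁ k₂ k₃ d 0) := by
    change ofImages d (tE2 q k₀ k₁ k₂ k₃ d) * ofImages d (tE3 q k₀ k₁ k₂ k₃ d) =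
      q⁻¹ • (((k₁ + k₁⁻¹) • (1 : Module.End F (Fin (d + 1) → F)) - ofImages d (tE1 q k₀ k₁ d)) *
        ((k₀ + k₀⁻¹) • (1 : Module.End F (Fin (d + 1) → F)) - ofImages d (tE0 q k₀ d)))
    have a2 := tE2_even (q := q) (k₀ := k₀) (k₁ := k₁) (k₂ := k₂) (k₃ := k₃) hd 0
    have a3 := tE3_even (q := q) (k₀ := k₀) (k₁ := k₁) (k₂ := k₂) (k₃ := k₃) (d := d) 0
    have b2 : ∀ m, ofImages d (tE2 q k₀ k₁ k₂ k₃ d) (vec d (2 * m + 2)) =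
      (k₀⁻¹ * k₁⁻¹ * k₃⁻¹ * (q ^ (2 * m) * q ^ 3)⁻¹) • (vec d (2 * m + 2) - vec d (2 * m + 3)) := by
      intro m
      have := tE2_even (q := q) (k₀ := k₀) (k₁ := k₁) (k₂ := k₂) (k₃ := k₃) hd (m + 1)
      rw [show q ^ (2 * (m + 1)) * q = q ^ (2 * m) * q ^ 3 by ring] at this
      exact this
    have b3 : ∀ m, ofImages d (tE3 q k₀ k₁ k₂ k₃ d) (vec d (2 * m + 2)) = k₃ • vec d (2 * m + 2) :=
      fun m => tE3_even (m + 1)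
    rw [mul_zero, pow_zero, one_mul, zero_add] at a2
    rw [mul_zero] at a3
    refine ext_vec ?_ (fun m => ?_) (fun m => ?_) <;>
    simp only [Module.End.mul_apply, LinearMap.sub_apply, LinearMap.smul_apply,
      map_sub,
      map_add, map_smul, Module.End.one_apply, tE0_zero, tE0_odd hq h₀ hk, tE0_even hd hk, tE1_zero, tE1_odd,
      tE1_even hd hk, a2, a3, b2, b3, tE2_even hd, tE2_odd hd, tE3_odd hd]
    · match_scalars <;> field_simp <;> ring
    · have := hp m
      generalize q ^ (2 * m) = p at *
      match_scalars <;> field_simp <;> ring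
    · have := hp m
      generalize q ^ (2 * m) = p at *
      match_scalars <;> field_simp <;> ring
  have m0 := tE_mul_sE (k₂ := k₂) (k₃ := k₃) hd hq h₀ h₁ h₂ h₃ hk 0
  have m1 := tE_mul_sE (k₂ := k₂) (k₃ := k₃) hd hq h₀ h₁ h₂ h₃ hk 1
  rw [mul_assoc, key, mul_smul_comm, ← mul_assoc, mul_assoc (tE q k₀ k₁ k₂ k₃ d 0), m1, mul_one, m0,
    Algebra.algebraMap_eq_smul_one]

end E

theorem k_rel {q k₀ : Fˣ} {d : ℕ} (hk : k₀ ^ 2 = q ^ (-(d : ℤ) - 1)) :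
    (k₀ : F) ^ 2 * (q : F) ^ (d + 1) = 1 := by
  have : k₀ ^ 2 * q ^ (d + 1) = 1 := by
    rw [hk, ← zpow_natCast q (d + 1), ← zpow_add]
    simp
  simpa using congrArg Units.val this

/-- The representation of `ℌ_q` on `F^{d+1}` that defines `E(k₀, k₁, k₂, k₃)`. -/
noncomputable def repE (q : Fˣ) (d : ℕ) (hd : Odd d) (k₀ k₁ k₂ k₃ : Fˣ) (hk : k₀ ^ 2 = q ^ (-(d : ℤ) - 1)) :
    DAHA q →ₐ[F] Module.End F (Fin (d + 1) → F) :=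
  DAHA.lift q (tE (q : F) k₀ k₁ k₂ k₃ d) (sE (q : F) k₀ k₁ k₂ k₃ d)
    (tE_mul_sE hd q.ne_zero k₀.ne_zero k₁.ne_zero k₂.ne_zero k₃.ne_zero (k_rel hk))
    (fun i => (tE_sE_comm i).trans
      (tE_mul_sE hd q.ne_zero k₀.ne_zero k₁.ne_zero k₂.ne_zero k₃.ne_zero (k_rel hk) i))
    (fun i z => by
      rw [sE, add_sub_cancel]
      exact (Commute.one_left z).smul_left _)
    (tE_prod hd q.ne_zero k₀.ne_zero k₁.ne_zero k₂.ne_zero k₃.ne_zero (k_rel hk))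

/-- The `(d+1)`-dimensional `ℌ_q`-module `E(k₀, k₁, k₂, k₃)`, for odd `d` and `k₀² = q^{-d-1}`. -/
def EModule (q : Fˣ) (d : ℕ) (_hd : Odd d) (k₀ _k₁ _k₂ _k₃ : Fˣ)
    (_hk : k₀ ^ 2 = q ^ (-(d : ℤ) - 1)) : Type _ := Fin (d + 1) → F

section
variable (q : Fˣ) (d : ℕ) (hd : Odd d) (k₀ k₁ k₂ k₃ : Fˣ) (hk : k₀ ^ 2 = q ^ (-(d : ℤ) - 1))

instance EModule.instAddCommGroup : AddCommGroup (EModule q d hd k₀ k₁ k₂ k₃ hk) :=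
  inferInstanceAs (AddCommGroup (Fin (d + 1) → F))

noncomputable instance EModule.instModule : Module (DAHA q) (EModule q d hd k₀ k₁ k₂ k₃ hk) :=
  Module.compHom (Fin (d + 1) → F) (repE q d hd k₀ k₁ k₂ k₃ hk).toRingHom

/-- The twisted module `V^{j mod 4}`: `x ∈ ℌ_q` acts on it as the image of `x` under `j mod 4` acts
on `V`. -/
abbrev Twist (j : ZMod 4) (V : Type*) [AddCommGroup V] [Module (DAHA q) V] : Type _ :=
  Pullback (DAHA.shift q j : DAHA q →ₐ[F] DAHA q) V

end

/-- The Hasse diagram of the bounded lattice `L` is the chain `⊥ - w - ⊤`. -/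
def IsChainLattice {L : Type*} [PartialOrder L] [BoundedOrder L] (w : L) : Prop :=
  ⊥ ⋖ w ∧ w ⋖ ⊤ ∧ ∀ u : L, u = ⊥ ∨ u = w ∨ u = ⊤

/-- The Hasse diagram of the bounded lattice `L` is the diamond with bottom `⊥`, top `⊤` and two
further distinct elements `w₁`, `w₂`, each of which lies between `⊥` and `⊤`. -/
def IsDiamondLattice {L : Type*} [PartialOrder L] [BoundedOrder L] (w₁ w₂ : L) : Prop :=
  w₁ ≠ w₂ ∧ ⊥ ⋖ w₁ ∧ ⊥ ⋖ w₂ ∧ w₁ ⋖ ⊤ ∧ w₂ ⋖ ⊤ ∧ ∀ u : L, u = ⊥ ∨ u = w₁ ∨ u = w₂ ∨ u = ⊤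

end AWDAHA

/-! On the twisted module the generator `t₀` acts as the operator `t₃` of `E`, and `A`, `C`, `B` act
as the operators `t_i t₃ + (t_i t₃)⁻¹` for `i = 0, 1, 2`; all three commute with `t₃`. Since each
`t_i + t_i⁻¹` is a scalar `c_i`, everything can be done with four operators on a vector space. Two
facts carry the proof.

First, △_q sees `t₃`. One of the Askey-Wilson relations expresses a combination of the three
operators as a scalar plus a multiple of `t₃`, and the multiple is nonzero because `c₀ = k₀ + k₀⁻¹`
vanishes only if `q^(d+1) = -1`. So every △_q-submodule is `t₃`-stable (`map_t₃_mem`).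

Second, let `W` be a nonzero △_q-submodule on which `t₃` is a scalar `θ`. Then `W + t₀W + t₁W + t₂W`
is stable under all `t_i` (`translateSup_stable`), hence is everything by irreducibility. As `t₃ -
θ⁻¹` sends each summand into `W`, it sends the whole space into `W` (`apply_sub_mem`).

If `θ ≠ θ⁻¹`, then `t₃ - θ⁻¹` is an invertible scalar on the `θ`-eigenspace, so that eigenspace has
no proper nonzero △_q-submodule. A `t₃`-stable subspace is the sum of its parts in the two
eigenspaces, and the diamond follows. If `θ = θ⁻¹`, then `N = t₃ - θ` has square zero, and
irreducibility of `E` makes the odd `ϱ_i` nonzero, which gives `ker N = range N`. A nonzero `W`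
inside `ker N` contains `range N`, so equals `ker N`; a `W` not inside `ker N` has `N W` nonzero, so
`N W = range N`, and then `W` is everything. -/

namespace AWDAHA

open DAHAAux

/-! ### The relations of `ℌ_q` as operator identities, and `t₃` as part of the △_q-action. -/

section Operators

variable {F V : Type*} [Field F] [AddCommGroup V] [Module F V]

/-- Operators `t₀, t₁, t₂, t₃` on a vector space satisfying the relations of `ℌ_q`, where
`t_i + t_i⁻¹` is the scalar `c_i`. -/
structure DAHAOperators (q : F) (t : ZMod 4 → Module.End F V) (c : ZMod 4 → F) : Prop where
  mul_inv : ∀ i, t i * (c i • 1 - t i) = 1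
  prod : t 0 * t 1 * t 2 * t 3 = algebraMap F _ q⁻¹

/-- The operator `t_i t₃ + (t_i t₃)⁻¹`. -/
def awOp (t : ZMod 4 → Module.End F V) (c : ZMod 4 → F) (i : ZMod 4) : Module.End F V :=
  t i * t 3 + (c 3 • 1 - t 3) * (c i • 1 - t i)

/-- `W` is stable under the action of the generators of `△_q` on the twisted module. -/
def AWStable (t : ZMod 4 → Module.End F V) (c : ZMod 4 → F) (W : Submodule F V) : Prop :=
  ∀ i, i ≠ 3 → ∀ w ∈ W, awOp t c i w ∈ W

variable {q : F} {t : ZMod 4 → Module.End F V} {c : ZMod 4 → F}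

namespace DAHAOperators

/-- The inverse `c i - t i` is a polynomial in `t i`, so a one-sided inverse is two-sided. The same
equation is the quadratic relation of `t i`. -/
theorem inv_mul (h : DAHAOperators q t c) (i : ZMod 4) : (c i • 1 - t i) * t i = 1 := by
  refine Eq.trans ?_ (h.mul_inv i)
  rw [sub_mul, mul_sub, smul_one_mul, mul_smul_one]

theorem central (i : ZMod 4) (z : Module.End F V) :
    Commute (t i + (c i • 1 - t i)) z := by
  rw [add_sub_cancel]
  exact (Commute.one_left z).smul_left _

theorem awOp_commute (h : DAHAOperators q t c) (i : ZMod 4) : Commute (awOp t c i) (t 3) :=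
  commute_of_central (h.mul_inv 3) (h.inv_mul 3) (central i) (central 3)

theorem awOp_comm_apply (h : DAHAOperators q t c) (i : ZMod 4) (v : V) :
    awOp t c i (t 3 v) = t 3 (awOp t c i v) :=
  LinearMap.congr_fun (h.awOp_commute i).eq v

theorem eq_of_prod (h : DAHAOperators q t c) :
    t 0 * t 1 = q⁻¹ • ((c 3 • 1 - t 3) * (c 2 • 1 - t 2)) := by
  have e : t 0 * t 1 = t 0 * t 1 * t 2 * t 3 * ((c 3 • 1 - t 3) * (c 2 • 1 - t 2)) := by
    rw [← mul_assoc, mul_assoc _ (t 3), h.mul_inv, mul_one, mul_assoc _ (t 2), h.mul_inv, mul_one]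
  rw [e, h.prod, Algebra.algebraMap_eq_smul_one, smul_mul_assoc, one_mul]

theorem prod_rotate (h : DAHAOperators q t c) :
    t 1 * t 2 * t 3 * t 0 = algebraMap F _ q⁻¹ :=
  DAHA.prod_cyc _ (h.inv_mul 0) h.prod

theorem prod_rotate₂ (h : DAHAOperators q t c) :
    t 2 * t 3 * t 0 * t 1 = algebraMap F _ q⁻¹ :=
  DAHA.prod_cyc _ (h.inv_mul 1) h.prod_rotate

theorem t₀_eq (h : DAHAOperators q t c) :
    t 0 = q⁻¹ • ((c 3 • 1 - t 3) * (c 2 • 1 - t 2) * (c 1 • 1 - t 1)) := by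
  rw [← smul_mul_assoc, ← h.eq_of_prod, mul_assoc, h.mul_inv, mul_one]

theorem inv₀_eq (h : DAHAOperators q t c) (hq : q ≠ 0) :
    c 0 • 1 - t 0 = q • (t 1 * t 2 * t 3) := by
  have e : t 1 * t 2 * t 3 = t 1 * t 2 * t 3 * t 0 * (c 0 • 1 - t 0) := by
    rw [mul_assoc _ (t 0), h.mul_inv, mul_one]
  rw [e, h.prod_rotate, Algebra.algebraMap_eq_smul_one, smul_mul_assoc, one_mul, smul_smul,
    mul_inv_cancel₀ hq, one_smul]

/-- The operator commutes with `t 3`, hence equals its conjugate `t₃t₀ + (t₃t₀)⁻¹`, and the product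
relation turns `t₃t₀` into `q⁻¹ t₂⁻¹ t₁⁻¹`. This is the shape in which the operator occurs in
`aw_identity`. -/
theorem awOp₀_eq (h : DAHAOperators q t c) (hq : q ≠ 0) :
    awOp t c 0 = q⁻¹ • ((c 2 • 1 - t 2) * (c 1 • 1 - t 1)) + q • (t 1 * t 2) := by
  refine conj_eq (h.mul_inv 3) (h.awOp_commute 0) ?_
  have e1 : t 3 * (t 0 * t 3) * (c 3 • 1 - t 3) = q⁻¹ • ((c 2 • 1 - t 2) * (c 1 • 1 - t 1)) := by
    rw [mul_assoc, mul_assoc (t 0), h.mul_inv, mul_one, h.t₀_eq, mul_smul_comm, ← mul_assoc,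
      ← mul_assoc, h.mul_inv, one_mul]
  have e2 : t 3 * ((c 3 • 1 - t 3) * (c 0 • 1 - t 0)) * (c 3 • 1 - t 3) = q • (t 1 * t 2) := by
    rw [← mul_assoc, h.mul_inv, one_mul, h.inv₀_eq hq, smul_mul_assoc, mul_assoc _ (t 3),
      h.mul_inv, mul_one]
  rw [awOp, mul_add, add_mul, e1, e2]

/-- A combination of the `awOp`s is the sum of a scalar and a multiple of `t₃`. -/
theorem aw_relation (h : DAHAOperators q t c) (hq : q ≠ 0) :
    (q ^ 2 - (q ^ 2)⁻¹) • awOp t c 0 + q • (awOp t c 2 * awOp t c 1)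
      - q⁻¹ • (awOp t c 1 * awOp t c 2)
    = (q - q⁻¹) • ((c 2 * c 1) • 1 + c 0 • (q • (c 3 • 1 - t 3) + q⁻¹ • t 3)) := by
  have hK : q • (t 1 * t 2 * t 3)
      + q⁻¹ • ((c 3 • 1 - t 3) * (c 2 • 1 - t 2) * (c 1 • 1 - t 1)) = c 0 • 1 := by
    rw [← h.inv₀_eq hq, ← h.t₀_eq, sub_add_cancel]
  -- Taken with `a = t₃`, `b = t₁`, `c = t₂`; by `hK` the central element `K` of that identity is
  -- `t₀⁻¹ + t₀ = c 0`.
  have key := aw_identity q hq (h.mul_inv 3) (h.inv_mul 3) (h.mul_inv 1) (h.inv_mul 1)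
    (h.mul_inv 2) (h.inv_mul 2) (central 3) (central 1) (central 2)
    (fun z => by rw [hK]; exact (Commute.one_left z).smul_left _)
  rw [hK, ← h.awOp₀_eq hq] at key
  refine key.trans ?_
  rw [add_sub_cancel, add_sub_cancel, smul_mul_smul_comm, one_mul, smul_mul_assoc, one_mul]

/-- `aw_relation` can be solved for `t 3`, since `c 0 ≠ 0` and `q² ≠ 1`. -/
theorem map_t₃_mem (h : DAHAOperators q t c) (hq : q ≠ 0) (hq2 : q ^ 2 ≠ 1) (hc : c 0 ≠ 0)
    {W : Submodule F V} (hW : AWStable t c W) {w : V} (hw : w ∈ W) : t 3 w ∈ W := by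
  have key := LinearMap.congr_fun (h.aw_relation hq) w
  simp only [LinearMap.add_apply, LinearMap.sub_apply, LinearMap.smul_apply,
    Module.End.mul_apply, Module.End.one_apply] at key
  have h0 := hW 0 (by decide) w hw
  have h1 := hW 1 (by decide) w hw
  have h2 := hW 2 (by decide) w hw
  have h12 := hW 1 (by decide) _ h2
  have h21 := hW 2 (by decide) _ h1
  -- The coefficient of `t 3` in `aw_relation` after replacing `t₃⁻¹` by `c 3 - t 3`.
  have hne : (q - q⁻¹) * (c 0 * (q⁻¹ - q)) ≠ 0 := by
    have : q - q⁻¹ ≠ 0 := by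
      intro e
      apply hq2
      field_simp at e
      linear_combination e
    have : q⁻¹ - q ≠ 0 := by rwa [← neg_sub, neg_ne_zero]
    positivity
  rw [← W.smul_mem_iff hne]
  have e : ((q - q⁻¹) * (c 0 * (q⁻¹ - q))) • t 3 w =
      (q ^ 2 - (q ^ 2)⁻¹) • awOp t c 0 w + q • awOp t c 2 (awOp t c 1 w)
      - q⁻¹ • awOp t c 1 (awOp t c 2 w)
      - ((q - q⁻¹) * (c 2 * c 1 + c 0 * q * c 3)) • w := by
    rw [key]; module
  rw [e]
  exact W.sub_mem (W.sub_mem (W.add_mem (W.smul_mem _ h0) (W.smul_mem _ h21))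
    (W.smul_mem _ h12)) (W.smul_mem _ hw)

/-- How `t₃` acts on `t_i u`, for an eigenvector `u` of `t₃`. -/
theorem t₃_t_apply {θ : F} {u : V} (hu : t 3 u = θ • u) (i : ZMod 4) :
    t 3 (t i u) = (c 3 - θ) • t i u + (awOp t c i u - (c i * (c 3 - θ)) • u) := by
  simp only [awOp, LinearMap.add_apply, LinearMap.sub_apply, LinearMap.smul_apply, map_sub,
    map_smul, Module.End.mul_apply, Module.End.one_apply, hu]
  module

end DAHAOperators

end Operators

/-! ### From △_q-submodules of an eigenspace of `t₃` to `ℌ_q`-submodules. -/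

section Operators

variable {F V : Type*} [Field F] [AddCommGroup V] [Module F V]
variable {q : F} {t : ZMod 4 → Module.End F V} {c : ZMod 4 → F}

/-- `W + t₀ W + t₁ W + t₂ W`. -/
def translateSup (t : ZMod 4 → Module.End F V) (W : Submodule F V) : Submodule F V :=
  W ⊔ ⨆ i : {i : ZMod 4 // i ≠ 3}, W.map (t i)

theorem mem_translateSup_of_mem {W : Submodule F V} {w : V} (hw : w ∈ W) :
    w ∈ translateSup t W :=
  (le_sup_left : W ≤ translateSup t W) hw

theorem apply_mem_translateSup {W : Submodule F V} {w : V} (hw : w ∈ W) {i : ZMod 4}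
    (hi : i ≠ 3) : t i w ∈ translateSup t W :=
  (le_trans (le_iSup (fun i : {i : ZMod 4 // i ≠ 3} => W.map (t i)) ⟨i, hi⟩) le_sup_right :
    W.map (t i) ≤ translateSup t W) ⟨w, hw, rfl⟩

theorem translateSup_le_comap {W M : Submodule F V} {f : Module.End F V}
    (h0 : ∀ w ∈ W, f w ∈ M) (h1 : ∀ i, i ≠ 3 → ∀ w ∈ W, f (t i w) ∈ M) :
    translateSup t W ≤ M.comap f := by
  refine sup_le h0 (iSup_le ?_)
  rintro ⟨i, hi⟩ _ ⟨w, hw, rfl⟩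
  exact h1 i hi w hw

namespace DAHAOperators

theorem t_t_apply (h : DAHAOperators q t c) (i : ZMod 4) (v : V) :
    t i (t i v) = c i • t i v - v := by
  have := LinearMap.congr_fun (h.inv_mul i) v
  simp only [Module.End.mul_apply, LinearMap.sub_apply, LinearMap.smul_apply,
    Module.End.one_apply] at this
  linear_combination (norm := module) -this

/-- By `hθ`, `c 3 - θ` stands for `θ⁻¹`. A product `t i (t j w)` falls under the quadratic relation
if `i = j` and under `t₃_t_apply` if `i = 3`. The six remaining products are shortened by the
relation `t₀t₁t₂t₃ = q⁻¹` to combinations of vectors of `W` and their images under a single `t_j`,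
with `t₃` acting on `W` as a scalar. -/
theorem translateSup_stable (h : DAHAOperators q t c) (hq : q ≠ 0) {θ : F}
    (hθ : θ * (c 3 - θ) = 1) {W : Submodule F V} (hW : AWStable t c W)
    (hWθ : ∀ w ∈ W, t 3 w = θ • w) (i : ZMod 4) :
    ∀ v ∈ translateSup t W, t i v ∈ translateSup t W := by
  set M := translateSup t W
  have m {w} (hw : w ∈ W) : w ∈ M := mem_translateSup_of_mem hw
  have mt {i} {w} (hi : i ≠ 3) (hw : w ∈ W) : t i w ∈ M := apply_mem_translateSup hw hi
  have n0 : (0 : ZMod 4) ≠ 3 := by decide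
  have n1 : (1 : ZMod 4) ≠ 3 := by decide
  have n2 : (2 : ZMod 4) ≠ 3 := by decide
  have mx {i} {w} (hi : i ≠ 3) (hw : w ∈ W) :
      awOp t c i w - (c i * (c 3 - θ)) • w ∈ W :=
    W.sub_mem (hW i hi w hw) (W.smul_mem _ hw)
  have ht3 (j : ZMod 4) {w} (hw : w ∈ W) := t₃_t_apply (c := c) (hWθ w hw) j
  have p12 {w} (hw : w ∈ W) : t 1 (t 2 w) = (q⁻¹ * (c 3 - θ)) • (c 0 • w - t 0 w) := by
    have := LinearMap.congr_fun (h.inv₀_eq hq) w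
    simp only [Module.End.mul_apply, LinearMap.sub_apply, LinearMap.smul_apply, hWθ w hw, map_smul,
      Module.End.one_apply] at this
    rw [this]
    match_scalars
    field_simp
    linear_combination -hθ
  have p01 {w} (hw : w ∈ W) :
      t 0 (t 1 w) = q⁻¹ • ((c 2 * (c 3 - θ)) • w - (c 3 - (c 3 - θ)) • t 2 w
        + (awOp t c 2 w - (c 2 * (c 3 - θ)) • w)) := by
    have := LinearMap.congr_fun h.eq_of_prod w
    simp only [Module.End.mul_apply, LinearMap.sub_apply, LinearMap.smul_apply, hWθ w hw, map_smul,
      map_sub, Module.End.one_apply, ht3 2 hw] at this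
    rw [this]
    module
  have hs21 : (c 2 • 1 - t 2) * (c 1 • 1 - t 1) = q • (t 3 * t 0) := by
    rw [h.t₀_eq, mul_smul_comm, smul_smul, mul_inv_cancel₀ hq, one_smul, ← mul_assoc, ← mul_assoc,
      h.mul_inv, one_mul]
  have hs10 : (c 1 • 1 - t 1) * (c 0 • 1 - t 0) = q • (t 2 * t 3) := by
    rw [h.inv₀_eq hq, mul_smul_comm, ← mul_assoc, ← mul_assoc, h.inv_mul, one_mul]
  have p21 {w} (hw : w ∈ W) : t 2 (t 1 w) = q • t 3 (t 0 w) - (c 2 * c 1) • w + c 2 • t 1 w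
      + c 1 • t 2 w := by
    have := LinearMap.congr_fun hs21 w
    simp only [Module.End.mul_apply, LinearMap.sub_apply, LinearMap.smul_apply, map_smul,
      map_sub, Module.End.one_apply] at this
    rw [← this]
    module
  have p10 {w} (hw : w ∈ W) : t 1 (t 0 w) = (q * θ) • t 2 w - (c 1 * c 0) • w + c 1 • t 0 w
      + c 0 • t 1 w := by
    have := LinearMap.congr_fun hs10 w
    simp only [Module.End.mul_apply, LinearMap.sub_apply, LinearMap.smul_apply, map_smul,
      map_sub, Module.End.one_apply, hWθ w hw] at this
    rw [mul_smul, ← this]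
    module
  -- The indices 0 and 2 are not cyclically adjacent, so `t₃` has to be placed between the factors:
  -- `t₂t₃t₀ = q⁻¹ t₁⁻¹`, and `t₃t₀w` is `θ⁻¹ t₀w` up to a vector of `W`.
  have p20 {w} (hw : w ∈ W) : t 2 (t 0 w) = θ • (q⁻¹ • (c 1 • w - t 1 w)
      - t 2 (awOp t c 0 w - (c 0 * (c 3 - θ)) • w)) := by
    have e : t 2 * t 3 * t 0 = q⁻¹ • (c 1 • 1 - t 1) := by
      have := congrArg (· * (c 1 • 1 - t 1)) h.prod_rotate₂
      simpa only [mul_assoc _ (t 1), h.mul_inv, mul_one, Algebra.algebraMap_eq_smul_one,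
        smul_one_mul] using this
    have := LinearMap.congr_fun e w
    simp only [Module.End.mul_apply, LinearMap.sub_apply, LinearMap.smul_apply, map_smul, map_add,
      Module.End.one_apply, ht3 0 hw] at this
    rw [← this, add_sub_cancel_right, smul_smul, hθ, one_smul]
  -- Likewise from `t₀⁻¹t₃⁻¹t₂⁻¹ = q t₁`, where `t₃⁻¹t₂⁻¹w` is `-θ t₂w` up to the vector `awOp t c 2
  -- w` of `W`.
  have p02 {w} (hw : w ∈ W) : t 0 (t 2 w) = c 0 • t 2 w - (c 3 - θ) • (c 0 • awOp t c 2 w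
      - t 0 (awOp t c 2 w) - q • t 1 w) := by
    have e : (c 0 • 1 - t 0) * (c 3 • 1 - t 3) * (c 2 • 1 - t 2) = q • t 1 := by
      rw [h.inv₀_eq hq, smul_mul_assoc, mul_assoc _ (t 3), h.mul_inv, mul_one, smul_mul_assoc,
        mul_assoc _ (t 2), h.mul_inv, mul_one]
    have := LinearMap.congr_fun e w
    simp only [Module.End.mul_apply, LinearMap.sub_apply, LinearMap.smul_apply, map_smul, map_add,
      map_sub, Module.End.one_apply, ht3 2 hw, hWθ w hw] at this
    rw [← this]
    match_scalars <;> first | ring1 | linear_combination -hθ | linear_combination c 0 * hθ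
  change translateSup t W ≤ M.comap (t i)
  refine translateSup_le_comap (fun w hw => ?_) (fun j hj w hw => ?_)
  · by_cases hi : i = 3
    · subst hi; rw [hWθ w hw]; exact M.smul_mem _ (m hw)
    · exact mt hi hw
  · have t3m {j} (hj : j ≠ 3) : t 3 (t j w) ∈ M := by
      rw [ht3 j hw]
      exact M.add_mem (M.smul_mem _ (mt hj hw)) (m (mx hj hw))
    have hm := m hw
    have h0 := mt n0 hw
    have h1 := mt n1 hw
    have h2 := mt n2 hw
    have hi : i = 0 ∨ i = 1 ∨ i = 2 ∨ i = 3 := by revert i; decide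
    have hj' : j = 0 ∨ j = 1 ∨ j = 2 := by revert j; decide
    rcases eq_or_ne i j with rfl | hij
    · rw [h.t_t_apply]; exact M.sub_mem (M.smul_mem _ (mt hj hw)) hm
    rcases hi with rfl | rfl | rfl | rfl
    · rcases hj' with rfl | rfl | rfl
      · exact absurd rfl hij
      · rw [p01 hw]
        exact M.smul_mem _ (M.add_mem (M.sub_mem (M.smul_mem _ hm) (M.smul_mem _ h2))
          (m (mx n2 hw)))
      · rw [p02 hw]
        have hx := hW 2 n2 w hw
        exact M.sub_mem (M.smul_mem _ h2) (M.smul_mem _ (M.sub_mem (M.sub_mem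
          (M.smul_mem _ (m hx)) (mt n0 hx)) (M.smul_mem _ h1)))
    · rcases hj' with rfl | rfl | rfl
      · rw [p10 hw]
        exact M.add_mem (M.add_mem (M.sub_mem (M.smul_mem _ h2) (M.smul_mem _ hm))
          (M.smul_mem _ h0)) (M.smul_mem _ h1)
      · exact absurd rfl hij
      · rw [p12 hw]
        exact M.smul_mem _ (M.sub_mem (M.smul_mem _ hm) h0)
    · rcases hj' with rfl | rfl | rfl
      · rw [p20 hw]
        exact M.smul_mem _ (M.sub_mem (M.smul_mem _ (M.sub_mem (M.smul_mem _ hm) h1))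
          (mt n2 (mx n0 hw)))
      · rw [p21 hw]
        exact M.add_mem (M.add_mem (M.sub_mem (M.smul_mem _ (t3m n0)) (M.smul_mem _ hm))
          (M.smul_mem _ h1)) (M.smul_mem _ h2)
      · exact absurd rfl hij
    · exact t3m hj

/-- If the operators act irreducibly, every nonzero `△_q`-submodule of the `θ`-eigenspace of `t₃`
contains the image of `t₃ - θ⁻¹`. -/
theorem apply_sub_mem (h : DAHAOperators q t c) (hq : q ≠ 0)
    (hirr : ∀ M : Submodule F V, (∀ i, ∀ v ∈ M, t i v ∈ M) → M = ⊥ ∨ M = ⊤) {θ : F}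
    (hθ : θ * (c 3 - θ) = 1) {W : Submodule F V} (hW : AWStable t c W)
    (hWθ : ∀ w ∈ W, t 3 w = θ • w) (hne : W ≠ ⊥) (v : V) : t 3 v - (c 3 - θ) • v ∈ W := by
  -- On `W` the operator `t₃ - θ⁻¹` is a scalar; on `t i w` only the `W`-valued error term of
  -- `t₃_t_apply` survives.
  have hle : translateSup t W ≤ W.comap (t 3 - (c 3 - θ) • 1) := by
    refine translateSup_le_comap (fun w hw => ?_) (fun i hi w hw => ?_)
    · simp only [LinearMap.sub_apply, LinearMap.smul_apply, Module.End.one_apply, hWθ w hw]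
      exact W.sub_mem (W.smul_mem _ hw) (W.smul_mem _ hw)
    · simp only [LinearMap.sub_apply, LinearMap.smul_apply, Module.End.one_apply,
        t₃_t_apply (c := c) (hWθ w hw) i]
      rw [add_sub_cancel_left]
      exact W.sub_mem (hW i hi w hw) (W.smul_mem _ hw)
  rcases hirr _ (h.translateSup_stable hq hθ hW hWθ) with hb | ht
  · exact absurd (eq_bot_iff.2 fun w hw => hb ▸ mem_translateSup_of_mem hw) hne
  · exact hle (ht ▸ Submodule.mem_top)

/-! ### Classification of the △_q-stable subspaces. -/

/-- The case `θ = θ⁻¹`. The hypothesis `hker` says that every eigenvector lies in the range of the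
square-zero operator `N = t₃ - θ`; it is what lets `apply_sub_mem` reach the whole eigenspace. -/
theorem eq_bot_or_eigenspace_or_top (h : DAHAOperators q t c) (hq : q ≠ 0) (hq2 : q ^ 2 ≠ 1)
    (hc : c 0 ≠ 0)
    (hirr : ∀ M : Submodule F V, (∀ i, ∀ v ∈ M, t i v ∈ M) → M = ⊥ ∨ M = ⊤) {θ : F}
    (hθ : θ * (c 3 - θ) = 1) (hθ' : c 3 - θ = θ)
    (hker : ∀ v, t 3 v = θ • v → ∃ x, v = t 3 x - θ • x)
    {W : Submodule F V} (hW : AWStable t c W) :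
    W = ⊥ ∨ (∀ w, w ∈ W ↔ t 3 w = θ • w) ∨ W = ⊤ := by
  have key {U : Submodule F V} (hU : AWStable t c U) (hUθ : ∀ w ∈ U, t 3 w = θ • w)
      (hne : U ≠ ⊥) (v : V) : t 3 v - θ • v ∈ U := by
    have := h.apply_sub_mem hq hirr hθ hU hUθ hne v
    rwa [hθ'] at this
  rcases eq_or_ne W ⊥ with hb | hne
  · exact Or.inl hb
  right
  by_cases hWθ : ∀ w ∈ W, t 3 w = θ • w
  · left
    refine fun w => ⟨hWθ w, fun hw => ?_⟩
    obtain ⟨x, rfl⟩ := hker w hw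
    exact key hW hWθ hne x
  right
  push Not at hWθ
  obtain ⟨w₀, hw₀, hne₀⟩ := hWθ
  set N : Module.End F V := t 3 - θ • 1 with hN
  have hNa (v : V) : N v = t 3 v - θ • v := rfl
  have hNN (v : V) : t 3 (N v) = θ • N v := by
    have e : c 3 = θ + θ := by linear_combination hθ'
    rw [hθ'] at hθ
    rw [hNa, map_sub, map_smul, smul_sub, smul_smul, hθ, h.t_t_apply, e]
    module
  have hst : AWStable t c (W.map N) := by
    rintro i hi _ ⟨w, hw, rfl⟩
    refine ⟨awOp t c i w, hW i hi w hw, ?_⟩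
    rw [hNa, hNa, map_sub, map_smul, h.awOp_comm_apply]
  have hle : W.map N ≤ W := by
    rintro _ ⟨w, hw, rfl⟩
    exact W.sub_mem (h.map_t₃_mem hq hq2 hc hW hw) (W.smul_mem _ hw)
  have hne' : W.map N ≠ ⊥ := by
    intro e
    have : N w₀ ∈ W.map N := ⟨w₀, hw₀, rfl⟩
    rw [e, Submodule.mem_bot, hNa, sub_eq_zero] at this
    exact hne₀ this
  -- `N W` is a nonzero stable subspace of the eigenspace, so it contains all of `range N`. Hence
  -- each `v` agrees with some `w ∈ W` up to `ker N`, which is in `range N` and so in `W`.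
  have hall : ∀ v, N v ∈ W.map N := key hst (by rintro _ ⟨w, -, rfl⟩; exact hNN w) hne'
  refine eq_top_iff.2 fun v _ => ?_
  obtain ⟨w, hw, hwv⟩ := hall v
  have h0 : t 3 (v - w) = θ • (v - w) := by
    rw [hNa, hNa] at hwv
    rw [map_sub, smul_sub]
    linear_combination (norm := module) -hwv
  obtain ⟨x, hx⟩ := hker _ h0
  have : v - w ∈ W := by rw [hx]; exact hle (hall x)
  simpa using W.add_mem this hw

/-- The part of `W` in the `θ`-eigenspace is again stable, and `t₃ - θ⁻¹` acts on that eigenspace as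
the nonzero scalar `θ - θ⁻¹`; by `apply_sub_mem` a nonzero part is the whole eigenspace. -/
theorem inf_eigenspace (h : DAHAOperators q t c) (hq : q ≠ 0)
    (hirr : ∀ M : Submodule F V, (∀ i, ∀ v ∈ M, t i v ∈ M) → M = ⊥ ∨ M = ⊤) {θ : F}
    (hθ : θ * (c 3 - θ) = 1) (hne : θ ≠ c 3 - θ) {W : Submodule F V} (hW : AWStable t c W) :
    (∀ w ∈ W, t 3 w = θ • w → w = 0) ∨ (∀ w, t 3 w = θ • w → w ∈ W) := by
  let U : Submodule F V := W ⊓ LinearMap.ker (t 3 - θ • 1)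
  have hU {w} : w ∈ U ↔ w ∈ W ∧ t 3 w = θ • w := by
    simp [U, sub_eq_zero]
  have hUs : AWStable t c U := by
    intro i hi w hw
    rw [hU] at hw ⊢
    exact ⟨hW i hi w hw.1, by rw [← h.awOp_comm_apply, hw.2, map_smul]⟩
  rcases eq_or_ne U ⊥ with hb | hb
  · exact Or.inl fun w hw hw' => by simpa [hb] using hU.2 ⟨hw, hw'⟩
  · refine Or.inr fun w hw => ?_
    have := h.apply_sub_mem hq hirr hθ hUs (fun w hw => (hU.1 hw).2) hb w
    rw [hw, ← sub_smul] at this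
    exact (hU.1 ((U.smul_mem_iff (sub_ne_zero.2 hne)).1 this)).1

/-- `W` is `t₃`-stable, so the two eigencomponents of its vectors lie in `W`. By `inf_eigenspace`
each eigenspace is either contained in `W` or meets it trivially, which leaves four cases. -/
theorem eq_of_ne (h : DAHAOperators q t c) (hq : q ≠ 0) (hq2 : q ^ 2 ≠ 1)
    (hc : c 0 ≠ 0)
    (hirr : ∀ M : Submodule F V, (∀ i, ∀ v ∈ M, t i v ∈ M) → M = ⊥ ∨ M = ⊤) {θ θ' : F}
    (hθ : θ * θ' = 1) (hc3 : c 3 = θ + θ') (hne : θ ≠ θ')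
    {W : Submodule F V} (hW : AWStable t c W) :
    W = ⊥ ∨ (∀ w, w ∈ W ↔ t 3 w = θ • w) ∨ (∀ w, w ∈ W ↔ t 3 w = θ' • w) ∨ W = ⊤ := by
  have e1 : c 3 - θ = θ' := by rw [hc3]; ring
  have e2 : c 3 - θ' = θ := by rw [hc3]; ring
  have i1 := h.inf_eigenspace hq hirr (θ := θ) (by rw [e1, hθ]) (by rwa [e1]) hW
  have i2 := h.inf_eigenspace hq hirr (θ := θ') (by rw [e2, mul_comm, hθ])
    (by rw [e2]; exact hne.symm) hW
  have sq (v : V) : t 3 (t 3 v) = (θ + θ') • t 3 v - v := by rw [h.t_t_apply, hc3]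
  have a1 (v : V) : t 3 (t 3 v - θ' • v) = θ • (t 3 v - θ' • v) := by
    rw [map_sub, sq, map_smul, smul_sub, smul_smul, hθ]; module
  have a2 (v : V) : t 3 (t 3 v - θ • v) = θ' • (t 3 v - θ • v) := by
    rw [map_sub, sq, map_smul, smul_sub, smul_smul, mul_comm, hθ]; module
  have m3 {w} (hw : w ∈ W) := h.map_t₃_mem hq hq2 hc hW hw
  have m1 {w} (hw : w ∈ W) : t 3 w - θ' • w ∈ W := W.sub_mem (m3 hw) (W.smul_mem _ hw)
  have m2 {w} (hw : w ∈ W) : t 3 w - θ • w ∈ W := W.sub_mem (m3 hw) (W.smul_mem _ hw)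
  have dec (v : V) : (θ - θ') • v = (t 3 v - θ' • v) - (t 3 v - θ • v) := by module
  have hne' := sub_ne_zero.2 hne
  rcases i1 with i1 | i1 <;> rcases i2 with i2 | i2
  · left
    refine (Submodule.eq_bot_iff _).2 fun w hw => ?_
    have := dec w
    rw [i1 _ (m1 hw) (a1 w), i2 _ (m2 hw) (a2 w), sub_zero] at this
    exact (smul_eq_zero.1 this).resolve_left hne'
  · right; right; left
    exact fun w => ⟨fun hw => sub_eq_zero.1 (i1 _ (m1 hw) (a1 w)), i2 w⟩
  · right; left
    exact fun w => ⟨fun hw => sub_eq_zero.1 (i2 _ (m2 hw) (a2 w)), i1 w⟩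
  · right; right; right
    refine eq_top_iff.2 fun v _ => (W.smul_mem_iff hne').1 ?_
    rw [dec]
    exact W.sub_mem (i1 _ (a1 v)) (i2 _ (a2 v))

end DAHAOperators

end Operators

/-! ### The explicit module: nonvanishing of the odd `ϱ_i`, and `ker = range` for `t₃ - k₃`. -/

section E

variable {F : Type*} [Field F] {q k₀ k₁ k₂ k₃ : F} {d : ℕ}

/-- The scalars `k_i + k_i⁻¹` by which `t_i + t_i⁻¹` acts on `E(k₀, k₁, k₂, k₃)`. -/
def cE (k₀ k₁ k₂ k₃ : F) (i : ZMod 4) : F :=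
  (![k₀, k₁, k₂, k₃] : ZMod 4 → F) i + ((![k₀, k₁, k₂, k₃] : ZMod 4 → F) i)⁻¹

theorem tE_operators (hd : Odd d) (hq : q ≠ 0) (h₀ : k₀ ≠ 0) (h₁ : k₁ ≠ 0) (h₂ : k₂ ≠ 0)
    (h₃ : k₃ ≠ 0) (hk : k₀ ^ 2 * q ^ (d + 1) = 1) :
    DAHAOperators q (tE q k₀ k₁ k₂ k₃ d) (cE k₀ k₁ k₂ k₃) where
  mul_inv i := tE_mul_sE hd hq h₀ h₁ h₂ h₃ hk i
  prod := tE_prod hd hq h₀ h₁ h₂ h₃ hk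

theorem vec_apply (n : ℕ) (j : Fin (d + 1)) :
    (vec d n : Fin (d + 1) → F) j = if (j : ℕ) = n then 1 else 0 := rfl

theorem span_vec_stable {n : ℕ} {f : Module.End F (Fin (d + 1) → F)}
    (hf : ∀ j, n ≤ j → f (vec d j) ∈ Submodule.span F (vec d '' Set.Ici n)) :
    ∀ v ∈ Submodule.span F (vec d '' Set.Ici n), f v ∈ Submodule.span F (vec d '' Set.Ici n) := by
  change Submodule.span F (vec d '' Set.Ici n) ≤ (Submodule.span F (vec d '' Set.Ici n)).comap f
  rw [Submodule.span_le]
  rintro _ ⟨j, hj, rfl⟩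
  exact hf j hj

/-- If one of the `ϱ_i` with `i` odd vanishes, `v_i, …, v_d` span a submodule. -/
theorem rho_ne_zero (hd : Odd d) (hq : q ≠ 0) (h₀ : k₀ ≠ 0)
    (hk : k₀ ^ 2 * q ^ (d + 1) = 1)
    (hirr : ∀ M : Submodule F (Fin (d + 1) → F),
      (∀ i, ∀ v ∈ M, tE q k₀ k₁ k₂ k₃ d i v ∈ M) → M = ⊥ ∨ M = ⊤)
    {m : ℕ} (hm : 2 * m + 1 ≤ d) :
    (k₀ * k₁ * k₃ * (q ^ (2 * m) * q) - k₂) * (k₀ * k₁ * k₃ * (q ^ (2 * m) * q) - k₂⁻¹) ≠ 0 := by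
  intro h
  -- Generators with index above `d` are zero, so the action formulas hold for every index and the
  -- top one needs no separate case.
  set M := Submodule.span F ((vec d : ℕ → Fin (d + 1) → F) '' Set.Ici (2 * m + 1)) with hM
  have mv {j : ℕ} (hj : 2 * m + 1 ≤ j) : (vec d j : Fin (d + 1) → F) ∈ M :=
    Submodule.subset_span ⟨j, hj, rfl⟩
  have hst : ∀ i, ∀ v ∈ M, tE q k₀ k₁ k₂ k₃ d i v ∈ M := by
    intro i
    have hi : i = 0 ∨ i = 1 ∨ i = 2 ∨ i = 3 := by revert i; decide
    refine span_vec_stable fun j hj => ?_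
    change _ ∈ M
    obtain ⟨l, rfl | rfl⟩ := Nat.even_or_odd' j
    -- An even `j ≥ 2m + 1` is at least 2, and its image involves no index below `j - 1 ≥ 2m + 1`.
    · obtain ⟨l, rfl⟩ : ∃ l', l = l' + 1 := ⟨l - 1, by omega⟩
      rcases hi with rfl | rfl | rfl | rfl
      · refine (tE0_even hd hk l).symm ▸ M.add_mem (M.smul_mem _ (mv ?_)) (M.smul_mem _ (mv hj))
        omega
      · refine (tE1_even hd hk l).symm ▸ M.add_mem (M.add_mem (M.smul_mem _ (mv ?_))
          (M.smul_mem _ (mv hj))) (M.smul_mem _ (mv ?_)) <;> omega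
      · have := tE2_even (q := q) (k₀ := k₀) (k₁ := k₁) (k₂ := k₂) (k₃ := k₃) hd (l + 1)
        exact this.symm ▸ M.smul_mem _ (M.sub_mem (mv hj) (mv (by omega)))
      · have := tE3_even (q := q) (k₀ := k₀) (k₁ := k₁) (k₂ := k₂) (k₃ := k₃) (d := d) (l + 1)
        exact this.symm ▸ M.smul_mem _ (mv hj)
    · rcases hi with rfl | rfl | rfl | rfl
      · refine (tE0_odd hq h₀ hk l).symm ▸ M.smul_mem _ (M.sub_mem (mv hj) (mv ?_))
        omega
      · exact (tE1_odd (q := q) (k₀ := k₀) (k₁ := k₁) l).symm ▸ M.smul_mem _ (mv hj)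
      · refine (tE2_odd (q := q) (k₀ := k₀) (k₁ := k₁) (k₂ := k₂) (k₃ := k₃) hd l).symm ▸ M.add_mem ?_ (M.smul_mem _ (mv hj))
        -- Only the odd index `2m + 1` itself could lead out of `M`, and there the coefficient of
        -- `v_{2m}` has the vanishing factor `ϱ_{2m+1}`.
        rcases eq_or_ne l m with rfl | hlm
        · rw [h, zero_div, zero_smul]; exact M.zero_mem
        · exact M.smul_mem _ (mv (by omega))
      · refine (tE3_odd (q := q) (k₀ := k₀) (k₁ := k₁) (k₂ := k₂) (k₃ := k₃) hd l).symm ▸ M.add_mem (M.add_mem ?_ (M.smul_mem _ (mv hj)))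
          (M.smul_mem _ (mv (by omega)))
        rcases eq_or_ne l m with rfl | hlm
        · rw [mul_assoc, h, mul_zero, neg_zero, zero_smul]; exact M.zero_mem
        · exact M.smul_mem _ (mv (by omega))
  rcases hirr M hst with hb | ht
  · have := mv le_rfl
    rw [hb, Submodule.mem_bot] at this
    have := congrFun this ⟨2 * m + 1, by omega⟩
    simp [vec_apply] at this
  · have h0 : M ≤ LinearMap.ker (LinearMap.proj (R := F) (φ := fun _ : Fin (d + 1) => F) 0) := by
      rw [hM, Submodule.span_le]
      rintro _ ⟨j, hj, rfl⟩
      have hj : 2 * m + 1 ≤ j := hj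
      exact if_neg (by change ¬ 0 = j; omega)
    have := h0 (ht ▸ Submodule.mem_top : (vec d 0 : Fin (d + 1) → F) ∈ M)
    simp [vec_apply] at this

theorem tE3_sub_odd (hd : Odd d) (h₃ : k₃ = k₃⁻¹) (m : ℕ) :
    ofImages d (tE3 q k₀ k₁ k₂ k₃ d) (vec d (2 * m + 1)) - k₃ • vec d (2 * m + 1) =
      -(k₃⁻¹ * ((k₀ * k₁ * k₃ * (q ^ (2 * m) * q) - k₂)
        * (k₀ * k₁ * k₃ * (q ^ (2 * m) * q) - k₂⁻¹))) • vec d (2 * m)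
        + k₃ • vec d (2 * m + 2) := by
  rw [tE3_odd hd, ← h₃]
  module

/-- By `tE3_sub_odd`, `v_{2m}` is in the range as soon as `v_{2m+2}` is, because `ϱ_{2m+1} ≠ 0`. The
descent starts from the zero vector beyond `v_d`; `j` bounds the distance to the top. -/
theorem vec_even_mem_range (hd : Odd d) (h₃ : k₃ = k₃⁻¹) (h₃' : k₃ ≠ 0)
    (hρ : ∀ m, 2 * m + 1 ≤ d → (k₀ * k₁ * k₃ * (q ^ (2 * m) * q) - k₂) *
      (k₀ * k₁ * k₃ * (q ^ (2 * m) * q) - k₂⁻¹) ≠ 0) (j m : ℕ) (hj : d ≤ 2 * m + j) :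
    (vec d (2 * m) : Fin (d + 1) → F) ∈
      LinearMap.range (ofImages d (tE3 q k₀ k₁ k₂ k₃ d) - k₃ • 1) := by
  induction j generalizing m with
  | zero =>
    obtain ⟨e, rfl⟩ := hd
    -- As `d` is odd, `d ≤ 2m` forces `d < 2m`.
    rw [vec_big (by omega)]
    exact Submodule.zero_mem _
  | succ j ih =>
    rcases lt_or_ge d (2 * m + 1) with h | h
    · exact ih m (by obtain ⟨e, rfl⟩ := hd; omega)
    have h2 := ih (m + 1) (by omega)
    have e := tE3_sub_odd (q := q) (k₀ := k₀) (k₁ := k₁) (k₂ := k₂) hd h₃ m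
    have h1 : ofImages d (tE3 q k₀ k₁ k₂ k₃ d) (vec d (2 * m + 1)) - k₃ • vec d (2 * m + 1) ∈
        LinearMap.range (ofImages d (tE3 q k₀ k₁ k₂ k₃ d) - k₃ • 1) := ⟨vec d (2 * m + 1), rfl⟩
    rw [e] at h1
    have h4 := (Submodule.add_mem_iff_left _ (Submodule.smul_mem _ k₃ h2)).1 h1
    exact (Submodule.smul_mem_iff _
      (neg_ne_zero.2 (mul_ne_zero (inv_ne_zero h₃') (hρ m h)))).1 h4

/-- With `k₃ = k₃⁻¹` the quadratic relation reads `(t₃ - k₃)² = 0`, so the range lies in the kernel.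
The range contains the `(d+1)/2` vectors `v_0, v_2, …, v_{d-1}`, half the dimension, so the two
coincide. -/
theorem exists_of_eigenvector (hd : Odd d) (h₃ : k₃ = k₃⁻¹) (h₃' : k₃ ≠ 0)
    (hρ : ∀ m, 2 * m + 1 ≤ d → (k₀ * k₁ * k₃ * (q ^ (2 * m) * q) - k₂) *
      (k₀ * k₁ * k₃ * (q ^ (2 * m) * q) - k₂⁻¹) ≠ 0)
    (hsq : ∀ v, ofImages d (tE3 q k₀ k₁ k₂ k₃ d) (ofImages d (tE3 q k₀ k₁ k₂ k₃ d) v)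
      = (k₃ + k₃⁻¹) • ofImages d (tE3 q k₀ k₁ k₂ k₃ d) v - v)
    (v : Fin (d + 1) → F) (hv : ofImages d (tE3 q k₀ k₁ k₂ k₃ d) v = k₃ • v) :
    ∃ x, v = ofImages d (tE3 q k₀ k₁ k₂ k₃ d) x - k₃ • x := by
  obtain ⟨n, rfl⟩ := id hd
  set N := ofImages (2 * n + 1) (tE3 q k₀ k₁ k₂ k₃ (2 * n + 1)) - k₃ • 1 with hN
  have hle : LinearMap.range N ≤ LinearMap.ker N := by
    rintro _ ⟨x, rfl⟩
    rw [LinearMap.mem_ker]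
    simp only [hN, LinearMap.sub_apply, LinearMap.smul_apply, Module.End.one_apply, map_sub,
      map_smul, hsq, ← h₃]
    have h1 : k₃ * k₃ = 1 := by nth_rewrite 1 [h₃]; exact inv_mul_cancel₀ h₃'
    rw [smul_sub, smul_smul, h1]
    module
  have hb : n + 1 ≤ Module.finrank F (LinearMap.range N) := by
    have hli : LinearIndependent F
        (fun m : Fin (n + 1) => (vec (2 * n + 1) (2 * m) : Fin (2 * n + 1 + 1) → F)) := by
      have := (Pi.basisFun F (Fin (2 * n + 1 + 1))).linearIndependent.comp
        (fun m : Fin (n + 1) => ⟨2 * m, by omega⟩) (fun a b hab => by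
          simp only [Fin.mk.injEq] at hab
          ext; omega)
      convert this using 1
      funext m
      exact vec_eq _ ⟨2 * m, by omega⟩
    have hc := finrank_span_eq_card hli
    rw [Fintype.card_fin] at hc
    rw [← hc]
    refine Submodule.finrank_mono (Submodule.span_le.2 ?_)
    rintro _ ⟨m, rfl⟩
    exact vec_even_mem_range hd h₃ h₃' hρ (2 * n + 1) m (by omega)
  have hr := LinearMap.finrank_range_add_finrank_ker N
  rw [Module.finrank_fin_fun] at hr
  -- The dimensions add up to `2n + 2` and the range has at least `n + 1`.
  have heq := Submodule.eq_of_le_of_finrank_le hle (by omega)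
  have hv' : v ∈ LinearMap.ker N := by
    rw [LinearMap.mem_ker, hN, LinearMap.sub_apply, hv]
    simp
  rw [← heq] at hv'
  obtain ⟨x, hx⟩ := hv'
  exact ⟨x, hx.symm⟩

end E

/-! ### Recognising the two Hasse diagrams. -/

theorem isChainLattice_of {L : Type*} [PartialOrder L] [BoundedOrder L] {w : L} (h0 : w ≠ ⊥)
    (h1 : w ≠ ⊤) (h : ∀ u : L, u = ⊥ ∨ u = w ∨ u = ⊤) : IsChainLattice w := by
  refine ⟨⟨bot_lt_iff_ne_bot.2 h0, fun u hu hu' => ?_⟩, ⟨lt_top_iff_ne_top.2 h1, fun u hu hu' => ?_⟩,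
    h⟩
  · rcases h u with rfl | rfl | rfl
    exacts [hu.false, hu'.false, not_top_lt hu']
  · rcases h u with rfl | rfl | rfl
    exacts [not_lt_bot hu, hu.false, hu'.false]

/-- Incomparability already separates `w₁` and `w₂` from `⊥` and `⊤`; the covering relations follow
because the list of elements is complete. -/
theorem isDiamondLattice_of {L : Type*} [PartialOrder L] [BoundedOrder L] {w₁ w₂ : L}
    (h12 : ¬ w₁ ≤ w₂) (h21 : ¬ w₂ ≤ w₁)
    (h : ∀ u : L, u = ⊥ ∨ u = w₁ ∨ u = w₂ ∨ u = ⊤) : IsDiamondLattice w₁ w₂ := by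
  have b1 : ⊥ < w₁ := bot_lt_iff_ne_bot.2 fun e => h12 (e ▸ bot_le)
  have b2 : ⊥ < w₂ := bot_lt_iff_ne_bot.2 fun e => h21 (e ▸ bot_le)
  have t1 : w₁ < ⊤ := lt_top_iff_ne_top.2 fun e => h21 (e ▸ le_top)
  have t2 : w₂ < ⊤ := lt_top_iff_ne_top.2 fun e => h12 (e ▸ le_top)
  refine ⟨fun e => h12 e.le, ⟨b1, fun u hu hu' => ?_⟩, ⟨b2, fun u hu hu' => ?_⟩,
    ⟨t1, fun u hu hu' => ?_⟩, ⟨t2, fun u hu hu' => ?_⟩, h⟩ <;>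
  rcases h u with rfl | rfl | rfl | rfl
  exacts [hu.false, hu'.false, h21 hu'.le, not_top_lt hu', hu.false, h12 hu'.le, hu'.false,
    not_top_lt hu', not_lt_bot hu, hu.false, h12 hu.le, hu'.false, not_lt_bot hu, h21 hu.le,
    hu.false, hu'.false]

/-! ### Translation between modules over the algebras and stable subspaces. -/

section

variable {F : Type*} [Field F] {q : Fˣ} {d : ℕ} {hd : Odd d} {k₀ k₁ k₂ k₃ : Fˣ}
  {hk : k₀ ^ 2 = q ^ (-(d : ℤ) - 1)}

theorem repE_t (i : ZMod 4) :
    repE q d hd k₀ k₁ k₂ k₃ hk (DAHA.t q i : DAHA q) = tE (q : F) k₀ k₁ k₂ k₃ d i :=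
  DAHA.lift_t ..

theorem repE_t_inv (i : ZMod 4) :
    repE q d hd k₀ k₁ k₂ k₃ hk ((DAHA.t q i)⁻¹ : (DAHA q)ˣ) = sE (q : F) k₀ k₁ k₂ k₃ d i :=
  DAHA.lift_t_inv ..

theorem shift_t (j i : ZMod 4) :
    DAHA.shift (F := F) q j (DAHA.t q i : DAHA q) = DAHA.t q (i + j) :=
  DAHA.lift_t ..

theorem shift_t_inv (j i : ZMod 4) :
    DAHA.shift (F := F) q j ((DAHA.t q i)⁻¹ : (DAHA q)ˣ) = ((DAHA.t q (i + j))⁻¹ : (DAHA q)ˣ) :=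
  DAHA.lift_t_inv ..

/-- Stability under the `t_i` suffices, since `t_i⁻¹` acts as `c_i - t_i`. -/
theorem repE_mem {M : Submodule F (Fin (d + 1) → F)}
    (hM : ∀ i, ∀ v ∈ M, tE (q : F) k₀ k₁ k₂ k₃ d i v ∈ M) (x : DAHA q) :
    ∀ v ∈ M, repE q d hd k₀ k₁ k₂ k₃ hk x v ∈ M := by
  obtain ⟨y, rfl⟩ := RingQuot.mkAlgHom_surjective F (DAHARel q) x
  induction y using FreeAlgebra.induction with
  | grade0 r =>
    intro v hv
    rw [AlgHom.commutes, AlgHom.commutes]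
    exact M.smul_mem r hv
  | grade1 g =>
    intro v hv
    cases g with
    | t i => exact (repE_t (hd := hd) (hk := hk) i).symm ▸ hM i v hv
    | tInv i =>
      refine (repE_t_inv (hd := hd) (hk := hk) i).symm ▸ ?_
      exact M.sub_mem (M.smul_mem _ hv) (hM i v hv)
  | mul a b ha hb =>
    intro v hv
    rw [map_mul, map_mul]
    exact ha _ (hb v hv)
  | add a b ha hb =>
    intro v hv
    rw [map_add, map_add]
    exact M.add_mem (ha v hv) (hb v hv)

theorem eq_bot_or_top_of_stable
    (hirr : IsSimpleModule (DAHA q) (EModule q d hd k₀ k₁ k₂ k₃ hk))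
    (M : Submodule F (Fin (d + 1) → F))
    (hM : ∀ i, ∀ v ∈ M, tE (q : F) k₀ k₁ k₂ k₃ d i v ∈ M) : M = ⊥ ∨ M = ⊤ := by
  let U : Submodule (DAHA q) (EModule q d hd k₀ k₁ k₂ k₃ hk) :=
    { carrier := {v | v ∈ M}
      zero_mem' := M.zero_mem
      add_mem' := fun ha hb => M.add_mem ha hb
      smul_mem' := fun x v hv => repE_mem hM x v hv }
  rcases eq_bot_or_eq_top U with h | h
  · left
    exact (Submodule.eq_bot_iff M).2 fun v hv => (Submodule.eq_bot_iff U).1 h v hv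
  · right
    exact Submodule.eq_top_iff'.2 fun v => Submodule.eq_top_iff'.1 h v

variable {hq : ¬ IsOfFinOrder q}

theorem mem_t0Eigenspace (θ : F) (v : Fin (d + 1) → F) :
    (v : Pullback (zeta q hq) (Twist q 3 (EModule q d hd k₀ k₁ k₂ k₃ hk))) ∈
      t0Eigenspace q hq (Twist q 3 (EModule q d hd k₀ k₁ k₂ k₃ hk)) θ ↔
    tE (q : F) k₀ k₁ k₂ k₃ d 3 v = θ • v := by
  change repE q d hd k₀ k₁ k₂ k₃ hk (DAHA.shift (F := F) q 3 (DAHA.t q 0 : DAHA q)) v =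
    repE q d hd k₀ k₁ k₂ k₃ hk (DAHA.shift (F := F) q 3 (algebraMap F (DAHA q) θ)) v ↔ _
  rw [shift_t, AlgEquiv.commutes, AlgHom.commutes, repE_t, zero_add]
  rfl

theorem repE_shift_symSum (i : ZMod 4) :
    repE q d hd k₀ k₁ k₂ k₃ hk (DAHA.shift (F := F) q 3
      (((DAHA.t q (i + 1) * DAHA.t q 0 : (DAHA q)ˣ) : DAHA q)
        + ((DAHA.t q (i + 1) * DAHA.t q 0)⁻¹ : (DAHA q)ˣ))) =
      awOp (tE (q : F) k₀ k₁ k₂ k₃ d) (cE (k₀ : F) k₁ k₂ k₃) i := by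
  have : i + 1 + 3 = i := by revert i; decide
  rw [mul_inv_rev, Units.val_mul, Units.val_mul, map_add, map_mul, map_mul, shift_t, shift_t,
    shift_t_inv, shift_t_inv, map_add, map_mul, map_mul, repE_t, repE_t, repE_t_inv, repE_t_inv,
    this, zero_add]
  rfl

/-- The vector space underlying a `△_q`-submodule of `E^{3 mod 4}`. -/
def toSubspace (u : Submodule (UAW q) (Pullback (zeta q hq)
    (Twist q 3 (EModule q d hd k₀ k₁ k₂ k₃ hk)))) : Submodule F (Fin (d + 1) → F) where
  carrier := {v | v ∈ u}
  zero_mem' := u.zero_mem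
  add_mem' ha hb := u.add_mem ha hb
  smul_mem' r v hv := by
    have h := u.smul_mem (algebraMap F (UAW q) r) hv
    have e : repE q d hd k₀ k₁ k₂ k₃ hk (DAHA.shift (F := F) q 3
        (zeta q hq (algebraMap F (UAW q) r))) v = r • v := by
      rw [AlgHom.commutes, AlgEquiv.commutes, AlgHom.commutes]
      rfl
    exact e ▸ h

theorem toSubspace_stable (u : Submodule (UAW q) (Pullback (zeta q hq)
    (Twist q 3 (EModule q d hd k₀ k₁ k₂ k₃ hk)))) :
    AWStable (tE (q : F) k₀ k₁ k₂ k₃ d) (cE (k₀ : F) k₁ k₂ k₃) (toSubspace u) := by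
  intro i hi w hw
  obtain ⟨g, hg⟩ : ∃ g, zetaGen q g =
      ((DAHA.t q (i + 1) * DAHA.t q 0 : (DAHA q)ˣ) : DAHA q)
        + ((DAHA.t q (i + 1) * DAHA.t q 0)⁻¹ : (DAHA q)ˣ) := by
    have hi' : i = 0 ∨ i = 1 ∨ i = 2 := by revert i; decide
    rcases hi' with rfl | rfl | rfl
    -- `ζ` uses `t₁t₀`, `t₃t₀`, `t₂t₀` for `A`, `B`, `C`, and the twist lowers every index by 1
    -- modulo 4; hence the order `A`, `C`, `B`.
    exacts [⟨.A, rfl⟩, ⟨.C, rfl⟩, ⟨.B, rfl⟩]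
  have h : repE q d hd k₀ k₁ k₂ k₃ hk (DAHA.shift (F := F) q 3 (zeta q hq (UAW.gen q g))) w ∈
    toSubspace u := u.smul_mem (UAW.gen q g) hw
  rwa [zeta_gen, hg, repE_shift_symSum] at h

theorem eq_bot_of_toSubspace {u : Submodule (UAW q) (Pullback (zeta q hq)
    (Twist q 3 (EModule q d hd k₀ k₁ k₂ k₃ hk)))} (h : toSubspace u = ⊥) : u = ⊥ :=
  (Submodule.eq_bot_iff u).2 fun w hw => (Submodule.eq_bot_iff (toSubspace u)).1 h w hw

theorem eq_top_of_toSubspace {u : Submodule (UAW q) (Pullback (zeta q hq)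
    (Twist q 3 (EModule q d hd k₀ k₁ k₂ k₃ hk)))} (h : toSubspace u = ⊤) : u = ⊤ :=
  Submodule.eq_top_iff'.2 fun w => (Submodule.eq_top_iff' (p := toSubspace u)).1 h w

theorem eq_t0Eigenspace_of_toSubspace {u : Submodule (UAW q) (Pullback (zeta q hq)
    (Twist q 3 (EModule q d hd k₀ k₁ k₂ k₃ hk)))} {θ : F}
    (h : ∀ w, w ∈ toSubspace u ↔ tE (q : F) k₀ k₁ k₂ k₃ d 3 w = θ • w) :
    u = t0Eigenspace q hq (Twist q 3 (EModule q d hd k₀ k₁ k₂ k₃ hk)) θ :=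
  Submodule.ext fun w => (h w).trans (mem_t0Eigenspace θ w).symm

/-- If `k₀² = -1`, then `k₀² q^(d+1) = 1` gives `q^(d+1) = -1`, and `q` is a root of unity. This is
the condition `c 0 ≠ 0` of `map_t₃_mem`. -/
theorem add_inv_ne_zero (hq : ¬ IsOfFinOrder q) (hk : k₀ ^ 2 = q ^ (-(d : ℤ) - 1)) :
    (k₀ : F) + (k₀ : F)⁻¹ ≠ 0 := by
  intro h
  apply hq
  rw [isOfFinOrder_iff_pow_eq_one]
  refine ⟨2 * (d + 1), by omega, ?_⟩
  ext
  have h1 := k_rel hk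
  have h0 : (k₀ : F) ≠ 0 := k₀.ne_zero
  field_simp at h
  have h2 : (q : F) ^ (d + 1) = -1 := by linear_combination -h1 + (q : F) ^ (d + 1) * h
  rw [Units.val_pow_eq_pow_val, mul_comm, pow_mul, h2]
  simp

theorem sq_ne_one (hq : ¬ IsOfFinOrder q) : (q : F) ^ 2 ≠ 1 := by
  intro h
  apply hq
  rw [isOfFinOrder_iff_pow_eq_one]
  exact ⟨2, by omega, by ext; simpa using h⟩

theorem vec_ne_zero {n : ℕ} (h : n ≤ d) : (vec d n : Fin (d + 1) → F) ≠ 0 := by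
  intro e
  have := congrFun e ⟨n, by omega⟩
  simp [vec_apply] at this

end

end AWDAHA

/-! ### The theorem. -/

open AWDAHA in
theorem mainTheorem7 {F : Type*} [Field F] [IsAlgClosed F]
    (q : Fˣ) (hq : ¬ IsOfFinOrder q) (d : ℕ) (hd : Odd d) (k₀ k₁ k₂ k₃ : Fˣ)
    (hk : k₀ ^ 2 = q ^ (-(d : ℤ) - 1))
    (hirr : IsSimpleModule (AWDAHA.DAHA q) (AWDAHA.EModule q d hd k₀ k₁ k₂ k₃ hk)) :
    (k₃ ^ 2 = 1 →
      AWDAHA.IsChainLattice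
        (AWDAHA.t0Eigenspace q hq
          (AWDAHA.Twist q 3 (AWDAHA.EModule q d hd k₀ k₁ k₂ k₃ hk)) (k₃ : F))) ∧
    (k₃ ^ 2 ≠ 1 →
      AWDAHA.IsDiamondLattice
        (AWDAHA.t0Eigenspace q hq
          (AWDAHA.Twist q 3 (AWDAHA.EModule q d hd k₀ k₁ k₂ k₃ hk)) (k₃ : F))
        (AWDAHA.t0Eigenspace q hq
          (AWDAHA.Twist q 3 (AWDAHA.EModule q d hd k₀ k₁ k₂ k₃ hk)) ((k₃⁻¹ : Fˣ) : F))) := by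
  have q0 := q.ne_zero
  have hd1 : 2 * 0 + 1 ≤ d := hd.pos
  have hrel := k_rel hk
  have hop := tE_operators (k₁ := (k₁ : F)) (k₂ := (k₂ : F)) (k₃ := (k₃ : F)) hd q0 k₀.ne_zero
    k₁.ne_zero k₂.ne_zero k₃.ne_zero hrel
  have hirr' := eq_bot_or_top_of_stable hirr
  have hc : cE (k₀ : F) k₁ k₂ k₃ 0 ≠ 0 := add_inv_ne_zero hq hk
  have hc3 : cE (k₀ : F) k₁ k₂ k₃ 3 = k₃ + (k₃ : F)⁻¹ := rfl
  have hsq := hop.t_t_apply 3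
  have hv0 : tE (q : F) k₀ k₁ k₂ k₃ d 3 (vec d 0) = (k₃ : F) • vec d 0 := tE3_even 0
  have hv1 : tE (q : F) k₀ k₁ k₂ k₃ d 3 (vec d 1) =
      -(k₃⁻¹ * (k₀ * k₁ * k₃ * ((q : F) ^ 0 * q) - k₂) * (k₀ * k₁ * k₃ * ((q : F) ^ 0 * q) - (k₂ : F)⁻¹))
        • vec d 0 + (k₃ : F)⁻¹ • vec d 1 + (k₃ : F) • vec d 2 := by
    have := tE3_odd (q := (q : F)) (k₀ := (k₀ : F)) (k₁ := k₁) (k₂ := k₂) (k₃ := k₃) hd 0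
    simp only [Units.val_inv_eq_inv_val]
    exact this
  have hρ := fun m => rho_ne_zero (m := m) hd q0 k₀.ne_zero hrel hirr'
  constructor
  · intro h3
    have h3' : (k₃ : F) = (k₃ : F)⁻¹ := by
      rw [← mul_eq_one_iff_eq_inv₀ k₃.ne_zero, ← sq]
      simpa using congrArg Units.val h3
    refine isChainLattice_of (fun h => ?_) (fun h => ?_) fun u => ?_
    · have hb := (Submodule.eq_bot_iff _).1 h
      exact vec_ne_zero (Nat.zero_le d) (hb _ ((mem_t0Eigenspace (hq := hq) (hd := hd) (hk := hk) _ _).2 hv0))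
    · have ht := Submodule.eq_top_iff'.1 h
      have : tE (q : F) k₀ k₁ k₂ k₃ d 3 (vec d 1) = (k₃ : F) • vec d 1 :=
        (mem_t0Eigenspace (hq := hq) (hd := hd) (hk := hk) _ _).1 (ht _)
      -- The coefficient of `v_0` in `t₃v_1` is `-k₃⁻¹ϱ_1`, which is nonzero, so `v_1` is not an
      -- eigenvector.
      have e := congrFun (hv1.symm.trans this) ⟨0, by omega⟩
      simp [vec_apply] at e
      have := hρ 0 hd1
      simp at this
      tauto
    · rcases hop.eq_bot_or_eigenspace_or_top q0 (sq_ne_one hq) hc hirr' (θ := k₃)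
        (by rw [hc3, add_sub_cancel_left, mul_inv_cancel₀ k₃.ne_zero])
        (by rw [hc3, add_sub_cancel_left, ← h3'])
        (exists_of_eigenvector hd h3' k₃.ne_zero hρ hsq) (toSubspace_stable u) with h | h | h
      · exact Or.inl (eq_bot_of_toSubspace h)
      · exact Or.inr (Or.inl (eq_t0Eigenspace_of_toSubspace h))
      · exact Or.inr (Or.inr (eq_top_of_toSubspace h))
  · intro h3
    have h3' : (k₃ : F) ≠ (k₃ : F)⁻¹ := by
      intro e
      rw [← mul_eq_one_iff_eq_inv₀ k₃.ne_zero, ← sq] at e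
      exact h3 (Units.ext (by simpa using e))
    rw [Units.val_inv_eq_inv_val]
    refine isDiamondLattice_of (fun h => ?_) (fun h => ?_) fun u => ?_
    · have := (mem_t0Eigenspace _ _).1
        (h ((mem_t0Eigenspace (hq := hq) (hd := hd) (hk := hk) _ _).2 hv0))
      rw [hv0] at this
      exact h3' (smul_left_injective F (vec_ne_zero (Nat.zero_le d)) this)
    -- By the quadratic relation `(t₃ - k₃)v_1` is in the `k₃⁻¹`-eigenspace. If it were in the other
    -- one too it would vanish, but its `v_1`-coordinate is `k₃⁻¹ - k₃ ≠ 0`.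
    · have hw : tE (q : F) k₀ k₁ k₂ k₃ d 3
          (tE (q : F) k₀ k₁ k₂ k₃ d 3 (vec d 1) - (k₃ : F) • vec d 1) =
          (k₃ : F)⁻¹ • (tE (q : F) k₀ k₁ k₂ k₃ d 3 (vec d 1) - (k₃ : F) • vec d 1) := by
        rw [map_sub, map_smul, hsq, hc3, smul_sub, smul_smul, inv_mul_cancel₀ k₃.ne_zero]
        module
      have := (mem_t0Eigenspace _ _).1
        (h ((mem_t0Eigenspace (hq := hq) (hd := hd) (hk := hk) _ _).2 hw))
      rw [hw] at this
      have hz : tE (q : F) k₀ k₁ k₂ k₃ d 3 (vec d 1) - (k₃ : F) • vec d 1 = 0 := by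
        by_contra hz
        exact h3' (smul_left_injective F hz this).symm
      rw [sub_eq_zero] at hz
      have e := congrFun (hv1.symm.trans hz) ⟨1, by omega⟩
      simp [vec_apply] at e
      exact h3' e.symm
    · rcases hop.eq_of_ne q0 (sq_ne_one hq) hc hirr' (mul_inv_cancel₀ k₃.ne_zero) hc3 h3'
        (toSubspace_stable u) with h | h | h | h
      · exact Or.inl (eq_bot_of_toSubspace h)
      · exact Or.inr (Or.inl (eq_t0Eigenspace_of_toSubspace h))
      · exact Or.inr (Or.inr (Or.inl (eq_t0Eigenspace_of_toSubspace h)))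
      · exact Or.inr (Or.inr (Or.inr (eq_top_of_toSubspace h)))
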